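/- Let $m,p\ge 1$, $n=m+p$, and let $\Lambda=\operatorname{diag}(\lambda_1,\dots,\lambda_n)\in C^{0,1}([0,1])^{n\times n}$ satisfy $$\lambda_1(x)<\cdots<\lambda_m(x)<0<\lambda_{m+1}(x)<\cdots<\lambda_{m+p}(x),\qquad x\in[0,1].$$ Write $v=(v_-,v_+)\in\mathbb R^m\times\mathbb R^p$ for $v\in\mathbb R^n$. For $Q\in\mathbb R^{p\times m}$ and $G\in L^\infty(0,1)^{n\times m}$, denote by $(\Lambda,-,Q,G)$ the control system $$\partial_t y+\Lambda(x)\,\partial_x y=G(x)\,y_-(t,0),\quad y_-(t,1)=u(t),\quad y_+(t,0)=Q\,y_-(t,0),\quad y(0,x)=y^0(x),$$ on $(0,T)\times(0,1)$, with $y^0\in L^2(0,1)^n$, $u\in L^2(0,T)^m$. Extend the $\lambda_i$ to Lipschitz functions on $\mathbb R$ that are bounded, bounded away from $0$, and keep their strict order and signs (for instance by constants outside $[0,1]$). Let $s\mapsto\chi_i(s;t,x)$ solve $\chi'=\lambda_i(\chi)$, $\chi(t)=x$, and let $s_i^{\rm in}(t,x)$ be the time $s$ at which $\chi_i(s;t,x)=1$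 if $i\le m$, respectively $\chi_i(s;t,x)=0$ if $i>m$. A solution in $(0,T)$ (along the characteristics) is a function $y\in C^0([0,T];L^2(0,1)^n)\cap C^0([0,1];L^2(0,T)^n)$ such that, for every $i$ and a.e. $(t,x)\in(0,T)\times(0,1)$, $$y_i(t,x)=b_i(t,x)+\sum_{j=1}^m\int_{\max\{0,s_i^{\rm in}(t,x)\}}^t g_{ij}(\chi_i(s;t,x))\,y_j(s,0)\,ds,$$ where $b_i(t,x)=y^0_i(\chi_i(0;t,x))$ if $s_i^{\rm in}(t,x)<0$, and, if $s_i^{\rm in}(t,x)>0$, $b_i(t,x)=u_i(s_i^{\rm in}(t,x))$ for $i\le m$ and $b_i(t,x)=\sum_{j=1}^m q_{i-m,j}\,y_j(s_i^{\rm in}(t,x),0)$ for $i>m$. We say that an invertible bounded linear map $R:L^2(0,1)^n\to L^2(0,1)^n$ transforms $(\Lambda,-,Q_1,G_1)$ into $(\Lambda,-,Q_2,G_2)$ if, for every $T>0$, the map $y\mapsto(t\mapsto R(y(t)))$ on $C^0([0,T];L^2(0,1)^n)$ sends the set of all solutions in $(0,T)$ of the first system (for all $y^0$ and $u$) onto the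 set of all those of the second. The two systems are equivalent, written $(\Lambda,-,Q_1,G_1)\sim(\Lambda,-,Q_2,G_2)$, if such an $R$ exists. **Proposition.** For every invertible upper triangular $U\in\mathbb R^{m\times m}$ and every invertible lower triangular $L\in\mathbb R^{p\times p}$, there exists a map $\Theta:L^\infty(0,1)^{n\times m}\to L^\infty(0,1)^{n\times m}$ such that, for every $Q\in\mathbb R^{p\times m}$ and every $G\in L^\infty(0,1)^{n\times m}$, $$(\Lambda,-,Q,G)\sim(\Lambda,-,LQU,\Theta(G)).$$ Moreover, all these equivalences are realized by one transformation $R$, which combines components along the characteristic changes of variables $\zeta_{ik}$, where $\zeta_{ik}'(s)=\lambda_k(\zeta_{ik}(s))/\lambda_i(s)$ and $\zeta_{ik}(0)=0$: for every $w \in L^2(0,1)^n$ and a.e. $x\in(0,1)$, $$(Rw)_i(x)=\sum_{k=i}^m (U^{-1})_{ik}\,w_k(\zeta_{ik}(x))\ \ (i\le m),\qquad (Rw)_i(x)=\sum_{k=m+1}^i L_{i-m,k-m}\,w_k(\zeta_{ik}(x))\ \ (i>m).$$ -/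

import Mathlib

open MeasureTheory Set

open scoped ENNReal NNReal Topology

noncomputable section

namespace HypSys

/-! ### Autonomous and separable scalar ODEs: existence and uniqueness -/

theorem bijective_of_le_deriv {f f' : ℝ → ℝ} {ε : ℝ} (hε : 0 < ε)
    (hf : ∀ x, HasDerivAt f (f' x) x) (h : ∀ x, ε ≤ f' x) : Function.Bijective f := by
  have hmono : StrictMono f :=
    strictMono_of_deriv_pos fun x => by rw [(hf x).deriv]; exact hε.trans_le (h x)
  have hcont : Continuous f := continuous_iff_continuousAt.2 fun x => (hf x).continuousAt
  have hd : ∀ x, HasDerivAt (fun x => f x - ε * x) (f' x - ε * 1) x := fun x =>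
    (hf x).sub ((hasDerivAt_id x).const_mul ε)
  have hm : Monotone fun x => f x - ε * x :=
    monotone_of_deriv_nonneg (fun x => (hd x).differentiableAt) fun x => by
      rw [(hd x).deriv]; linarith [h x]
  refine ⟨hmono.injective, hcont.surjective ?_ ?_⟩
  · refine Filter.tendsto_atTop_mono' _ ?_
      (Filter.tendsto_atTop_add_const_right _ (f 0) (Filter.tendsto_id.const_mul_atTop hε))
    filter_upwards [Filter.eventually_ge_atTop (0 : ℝ)] with x hx
    have := hm hx
    simp only [id] at *
    linarith
  · refine Filter.tendsto_atBot_mono' _ ?_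
      (Filter.tendsto_atBot_add_const_right _ (f 0) (Filter.tendsto_id.const_mul_atBot hε))
    filter_upwards [Filter.eventually_le_atBot (0 : ℝ)] with x hx
    have := hm hx
    simp only [id] at *
    linarith

theorem existsUnique_ode_pos {a b : ℝ → ℝ} (ha : Continuous a) (hb : Continuous b)
    (ha0 : ∀ x, a x ≠ 0) {C : ℝ} (hb0 : ∀ x, 0 < b x) (hC : ∀ x, b x ≤ C) (s₀ x₀ : ℝ) :
    ∃! f : ℝ → ℝ, f s₀ = x₀ ∧ ∀ s, HasDerivAt f (b (f s) / a s) s := by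
  set A : ℝ → ℝ := fun s => ∫ ξ in s₀..s, (a ξ)⁻¹ with hA
  set B : ℝ → ℝ := fun y => ∫ ξ in x₀..y, (b ξ)⁻¹ with hB
  have hCpos : 0 < C := (hb0 0).trans_le (hC 0)
  have hAd : ∀ s, HasDerivAt A (a s)⁻¹ s := fun s =>
    (ha.inv₀ ha0).integral_hasStrictDerivAt s₀ s |>.hasDerivAt
  have hBd : ∀ y, HasDerivAt B (b y)⁻¹ y := fun y =>
    (hb.inv₀ fun x => (hb0 x).ne').integral_hasStrictDerivAt x₀ y |>.hasDerivAt
  have hBbij : Function.Bijective B :=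
    bijective_of_le_deriv (inv_pos.2 hCpos) hBd fun x => inv_anti₀ (hb0 x) (hC x)
  have hBmono : StrictMono B :=
    strictMono_of_deriv_pos fun x => by rw [(hBd x).deriv]; exact inv_pos.2 (hb0 x)
  let e : ℝ ≃o ℝ := hBmono.orderIsoOfSurjective B hBbij.2
  have heB : ∀ y, e y = B y := fun y => rfl
  have hA0 : A s₀ = 0 := by simp [hA]
  have hB0 : B x₀ = 0 := by simp [hB]
  refine ⟨fun s => e.symm (A s), ⟨?_, fun s => ?_⟩, ?_⟩
  · have : e.symm (e x₀) = x₀ := e.symm_apply_apply x₀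
    rwa [heB, hB0, ← hA0] at this
  · have h1 : HasDerivAt (fun z => e.symm z) ((b (e.symm (A s)))⁻¹)⁻¹ (A s) := by
      refine HasDerivAt.of_local_left_inverse e.symm.continuous.continuousAt
        (hBd _) (inv_ne_zero (hb0 _).ne') (Filter.Eventually.of_forall fun z => ?_)
      exact e.apply_symm_apply z
    have h2 := h1.comp s (hAd s)
    rw [inv_inv, ← div_eq_mul_inv] at h2
    exact h2
  · rintro g ⟨hg0, hg⟩
    have hd : ∀ s, HasDerivAt (fun s => B (g s) - A s) 0 s := fun s => by
      have h := ((hBd (g s)).comp s (hg s)).sub (hAd s)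
      have h0 : (b (g s))⁻¹ * (b (g s) / a s) - (a s)⁻¹ = 0 := by
        have := (hb0 (g s)).ne'
        have := ha0 s
        field_simp
        ring
      rw [h0] at h
      exact h
    funext s
    have hc := is_const_of_deriv_eq_zero (fun s => (hd s).differentiableAt)
      (fun s => (hd s).deriv) s s₀
    simp only [hg0, hB0, hA0, sub_zero] at hc
    have : e (g s) = A s := by rw [heB]; linarith
    rw [← this, e.symm_apply_apply]

theorem existsUnique_ode {a b : ℝ → ℝ} (ha : Continuous a) (hb : Continuous b)
    (ha0 : ∀ x, a x ≠ 0) {C : ℝ} (hb0 : (∀ x, 0 < b x) ∨ ∀ x, b x < 0) (hC : ∀ x, |b x| ≤ C)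
    (s₀ x₀ : ℝ) :
    ∃! f : ℝ → ℝ, f s₀ = x₀ ∧ ∀ s, HasDerivAt f (b (f s) / a s) s := by
  rcases hb0 with hb0 | hb0
  · exact existsUnique_ode_pos ha hb ha0 hb0 (fun x => (le_abs_self _).trans (hC x)) s₀ x₀
  · obtain ⟨g, ⟨hg0, hg⟩, hu⟩ := existsUnique_ode_pos (b := fun y => -b (-y)) ha
      (hb.comp continuous_neg).neg ha0 (fun x => neg_pos.2 (hb0 _))
      (fun x => (neg_le_abs _).trans (hC _)) s₀ (-x₀)
    refine ⟨fun s => -g s, ⟨by simp [hg0], fun s => ?_⟩, ?_⟩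
    · have := (hg s).neg
      rwa [neg_div, neg_neg] at this
    · rintro f ⟨hf0, hf⟩
      have h1 : ∀ s, HasDerivAt (fun s => -f s) (-b (- -f s) / a s) s := fun s => by
        have := (hf s).neg
        rw [← neg_div] at this
        rw [neg_neg]
        exact this
      have h2 := hu (fun s => -f s) ⟨by simp [hf0], h1⟩
      funext s
      have h3 : -f s = g s := congrFun h2 s
      show f s = -g s
      linarith

/-! ### The speeds -/

/-- The `n = m + p` components: the first `m` ones (`Sum.inl`) are the components `-`,
the last `p` ones (`Sum.inr`) are the components `+`. -/
abbrev Idx (m p : ℕ) : Type := Fin m ⊕ Fin p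

/-- The diagonal matrix `Λ = diag (λ_1, …, λ_n)`, with Lipschitz entries on `[0,1]` such that
`λ_1 < ⋯ < λ_m < 0 < λ_{m+1} < ⋯ < λ_{m+p}` pointwise on `[0,1]`. -/
structure Speeds (m p : ℕ) where
  lam : Idx m p → unitInterval → ℝ
  lipschitz : ∀ i, ∃ K : ℝ≥0, LipschitzWith K (lam i)
  neg : ∀ (i : Fin m) (x : unitInterval), lam (Sum.inl i) x < 0
  pos : ∀ (k : Fin p) (x : unitInterval), 0 < lam (Sum.inr k) x
  strictMono_neg : ∀ x : unitInterval, StrictMono fun i : Fin m => lam (Sum.inl i) x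
  strictMono_pos : ∀ x : unitInterval, StrictMono fun k : Fin p => lam (Sum.inr k) x

namespace Speeds

variable {m p : ℕ} (Λ : Speeds m p)

/-- The speeds are extended to `ℝ` by constants on both sides of `[0,1]`; the extension is
Lipschitz and keeps the strict order and the signs. -/
def ext (i : Idx m p) : ℝ → ℝ := Set.IccExtend zero_le_one (Λ.lam i)

theorem continuous_ext (i : Idx m p) : Continuous (Λ.ext i) := by
  obtain ⟨K, hK⟩ := Λ.lipschitz i
  exact hK.continuous.Icc_extend'

theorem ext_sign (i : Idx m p) : (∀ x, 0 < Λ.ext i x) ∨ ∀ x, Λ.ext i x < 0 := by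
  rcases i with i | k
  · exact Or.inr fun x => Λ.neg i _
  · exact Or.inl fun x => Λ.pos k _

theorem ext_ne_zero (i : Idx m p) (x : ℝ) : Λ.ext i x ≠ 0 := by
  rcases Λ.ext_sign i with h | h
  exacts [(h x).ne', (h x).ne]

theorem exists_bounds (i : Idx m p) :
    ∃ ε C : ℝ, 0 < ε ∧ ∀ x, ε ≤ |Λ.ext i x| ∧ |Λ.ext i x| ≤ C := by
  obtain ⟨K, hK⟩ := Λ.lipschitz i
  have hc : Continuous fun x => |Λ.lam i x| := hK.continuous.abs
  obtain ⟨x₁, -, h₁⟩ := isCompact_univ.exists_isMinOn univ_nonempty hc.continuousOn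
  obtain ⟨x₂, -, h₂⟩ := isCompact_univ.exists_isMaxOn univ_nonempty hc.continuousOn
  refine ⟨|Λ.lam i x₁|, |Λ.lam i x₂|, abs_pos.2 ?_, fun x =>
    ⟨h₁ (mem_univ (projIcc 0 1 zero_le_one x)), h₂ (mem_univ (projIcc 0 1 zero_le_one x))⟩⟩
  rcases i with i | k
  exacts [(Λ.neg i _).ne, (Λ.pos k _).ne']

/-! ### Characteristics -/

theorem existsUnique_chi (i : Idx m p) (t x : ℝ) :
    ∃! f : ℝ → ℝ, f t = x ∧ ∀ s, HasDerivAt f (Λ.ext i (f s)) s := by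
  obtain ⟨ε, C, -, hC⟩ := Λ.exists_bounds i
  have := existsUnique_ode (a := fun _ => 1) continuous_const (Λ.continuous_ext i)
    (fun _ => one_ne_zero) (Λ.ext_sign i) (fun x => (hC x).2) t x
  simpa only [div_one] using this

/-- The characteristic `s ↦ χ_i(s; t, x)`: the solution of `χ' = λ_i(χ)`, `χ(t) = x`. -/
def chi (i : Idx m p) (s t x : ℝ) : ℝ := (Λ.existsUnique_chi i t x).choose s

theorem chi_self (i : Idx m p) (t x : ℝ) : Λ.chi i t t x = x :=
  (Λ.existsUnique_chi i t x).choose_spec.1.1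

theorem hasDerivAt_chi (i : Idx m p) (s t x : ℝ) :
    HasDerivAt (fun s => Λ.chi i s t x) (Λ.ext i (Λ.chi i s t x)) s :=
  (Λ.existsUnique_chi i t x).choose_spec.1.2 s

/-- The end point of `[0,1]` through which the `i`-th characteristics enter. -/
def entryPoint : Idx m p → ℝ
  | Sum.inl _ => 1
  | Sum.inr _ => 0

theorem existsUnique_sIn (i : Idx m p) (t x : ℝ) : ∃! s : ℝ, Λ.chi i s t x = entryPoint i := by
  obtain ⟨ε, C, hε, hC⟩ := Λ.exists_bounds i
  have hbij : Function.Bijective fun s => Λ.chi i s t x := by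
    rcases Λ.ext_sign i with h | h
    · refine bijective_of_le_deriv hε (fun s => Λ.hasDerivAt_chi i s t x) fun s => ?_
      rw [← abs_of_pos (h _)]
      exact (hC _).1
    · have := bijective_of_le_deriv hε (fun s => (Λ.hasDerivAt_chi i s t x).neg) fun s => by
        rw [← abs_of_neg (h _)]
        exact (hC _).1
      exact (Equiv.neg ℝ).bijective.of_comp_iff' _ |>.1 this
  exact hbij.existsUnique _

/-- The entry time `s_i^in(t,x)`: the time at which the characteristic `χ_i(·; t, x)` is at
`1` (for `i ≤ m`), resp. at `0` (for `i > m`). -/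
def sIn (i : Idx m p) (t x : ℝ) : ℝ := (Λ.existsUnique_sIn i t x).choose

theorem chi_sIn (i : Idx m p) (t x : ℝ) : Λ.chi i (Λ.sIn i t x) t x = entryPoint i :=
  (Λ.existsUnique_sIn i t x).choose_spec.1

theorem existsUnique_zeta (i j : Idx m p) :
    ∃! f : ℝ → ℝ, f 0 = 0 ∧ ∀ s, HasDerivAt f (Λ.ext j (f s) / Λ.ext i s) s := by
  obtain ⟨ε, C, -, hC⟩ := Λ.exists_bounds j
  exact existsUnique_ode (Λ.continuous_ext i) (Λ.continuous_ext j) (Λ.ext_ne_zero i)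
    (Λ.ext_sign j) (fun x => (hC x).2) 0 0

/-- The characteristic change of variables `ζ_{ij}`: the solution of
`ζ'(s) = λ_j(ζ(s)) / λ_i(s)`, `ζ(0) = 0`. -/
def zeta (i j : Idx m p) : ℝ → ℝ := (Λ.existsUnique_zeta i j).choose

theorem zeta_zero (i j : Idx m p) : Λ.zeta i j 0 = 0 :=
  (Λ.existsUnique_zeta i j).choose_spec.1.1

theorem hasDerivAt_zeta (i j : Idx m p) (s : ℝ) :
    HasDerivAt (Λ.zeta i j) (Λ.ext j (Λ.zeta i j s) / Λ.ext i s) s :=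
  (Λ.existsUnique_zeta i j).choose_spec.1.2 s

end Speeds

/-! ### Function spaces -/

/-- Lebesgue measure on the interval `(0,a)`. -/
abbrev leb (a : ℝ) : Measure ℝ := volume.restrict (Ioo 0 a)

/-- `L²(0,a)`. -/
abbrev L2 (a : ℝ) : Type := Lp ℝ 2 (leb a)

/-- `L^∞(0,1)`. -/
abbrev LInf : Type := Lp ℝ ∞ (leb 1)

/-- The state space `L²(0,1)^n`. -/
abbrev State (m p : ℕ) : Type := Idx m p → L2 1

/-! ### Solutions along the characteristics

The system `(Λ, -, Q, G)` is
`∂_t y + Λ(x) ∂_x y = G(x) y_-(t,0)`, `y_-(t,1) = u(t)`, `y_+(t,0) = Q y_-(t,0)`,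
`y(0,x) = y⁰(x)`. -/

/-- The value carried by the `i`-th characteristic at the time `max 0 (s_i^in(t,x))`: control
(`i ≤ m`) or boundary coupling (`i > m`) if `s_i^in(t,x) > 0`, initial data otherwise.
Here `v` is the trace `y_-(·,0)`. -/
def bdry {m p : ℕ} (Λ : Speeds m p) (Q : Matrix (Fin p) (Fin m) ℝ) (y₀ : Idx m p → ℝ → ℝ)
    (u v : Fin m → ℝ → ℝ) (i : Idx m p) (t x : ℝ) : ℝ :=
  if 0 < Λ.sIn i t x then
    match i with
    | Sum.inl i' => u i' (Λ.sIn i t x)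
    | Sum.inr k => ∑ j, Q k j * v j (Λ.sIn i t x)
  else y₀ i (Λ.chi i 0 t x)

/-- `y : (0,T) × (0,1) → ℝⁿ` is the solution in `(0,T)` of the system `(Λ, -, Q, G)` with initial
data `y₀` and control `u`. The element `Y` of `C⁰([0,T]; L²(0,1)^n)` and the element `Z` of
`C⁰([0,1]; L²(0,T)^n)` are those given by `y`; in particular `Z 0` is the trace `y(·,0)`. -/
structure IsSolution {m p : ℕ} (Λ : Speeds m p) (Q : Matrix (Fin p) (Fin m) ℝ)
    (G : Matrix (Idx m p) (Fin m) LInf) (T : ℝ) (y₀ : State m p) (u : Fin m → L2 T)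
    (y : ℝ × ℝ → Idx m p → ℝ) (Y : C(Icc (0 : ℝ) T, State m p))
    (Z : C(unitInterval, Idx m p → L2 T)) : Prop where
  measurable : AEStronglyMeasurable y ((leb T).prod (leb 1))
  time : ∀ i, ∀ᵐ t ∂(leb T), ∀ ht : t ∈ Icc 0 T, (fun x => y (t, x) i) =ᵐ[leb 1] Y ⟨t, ht⟩ i
  space : ∀ i, ∀ᵐ x ∂(leb 1), ∀ hx : x ∈ Icc 0 1, (fun t => y (t, x) i) =ᵐ[leb T] Z ⟨x, hx⟩ i
  eqn : ∀ i, ∀ᵐ q ∂((leb T).prod (leb 1)),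
    y q i = bdry Λ Q (fun k => y₀ k) (fun j => u j) (fun j => Z 0 (Sum.inl j)) i q.1 q.2
      + ∑ j, ∫ s in (max 0 (Λ.sIn i q.1 q.2))..q.1,
          G i j (Λ.chi i s q.1 q.2) * Z 0 (Sum.inl j) s

/-- The space of all the solutions in `(0,T)` of the system `(Λ, -, Q, G)` (for all initial data
and all controls), as a subset of `C⁰([0,T]; L²(0,1)^n)`. -/
def solutions {m p : ℕ} (Λ : Speeds m p) (Q : Matrix (Fin p) (Fin m) ℝ)
    (G : Matrix (Idx m p) (Fin m) LInf) (T : ℝ) : Set C(Icc (0 : ℝ) T, State m p) :=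
  {Y | ∃ y₀ u y Z, IsSolution Λ Q G T y₀ u y Y Z}

/-! ### Equivalent systems -/

/-- For every `T > 0`, the map `y ↦ (t ↦ R (y t))` sends the space of the solutions in `(0,T)` of
`(Λ, -, Q₁, G₁)` onto that of `(Λ, -, Q₂, G₂)`. -/
def Transforms {m p : ℕ} (Λ : Speeds m p) (R : State m p ≃L[ℝ] State m p)
    (Q₁ : Matrix (Fin p) (Fin m) ℝ) (G₁ : Matrix (Idx m p) (Fin m) LInf)
    (Q₂ : Matrix (Fin p) (Fin m) ℝ) (G₂ : Matrix (Idx m p) (Fin m) LInf) : Prop :=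
  ∀ T : ℝ, 0 < T →
    (fun Y : C(Icc (0 : ℝ) T, State m p) =>
      (⟨R, R.continuous⟩ : C(State m p, State m p)).comp Y) '' solutions Λ Q₁ G₁ T
      = solutions Λ Q₂ G₂ T

/-- The equivalence `(Λ, -, Q₁, G₁) ∼ (Λ, -, Q₂, G₂)`. -/
def Equivalent {m p : ℕ} (Λ : Speeds m p)
    (Q₁ : Matrix (Fin p) (Fin m) ℝ) (G₁ : Matrix (Idx m p) (Fin m) LInf)
    (Q₂ : Matrix (Fin p) (Fin m) ℝ) (G₂ : Matrix (Idx m p) (Fin m) LInf) : Prop :=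
  ∃ R : State m p ≃L[ℝ] State m p, Transforms Λ R Q₁ G₁ Q₂ G₂

/-- `R w` is obtained by combining the components of `w` along the characteristic changes of
variables: `(R w)_i = ∑_{k = i}^m A_{ik} w_k(ζ_{ik}(·))` for `i ≤ m` and
`(R w)_i = ∑_{k = m+1}^i B_{i-m,k-m} w_k(ζ_{ik}(·))` for `i > m`. -/
def IsCharacteristicCombination {m p : ℕ} (Λ : Speeds m p) (A : Matrix (Fin m) (Fin m) ℝ)
    (B : Matrix (Fin p) (Fin p) ℝ) (R : State m p → State m p) : Prop :=
  ∀ w : State m p,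
    (∀ i : Fin m, R w (Sum.inl i) =ᵐ[leb 1] fun x =>
      ∑ k ∈ Finset.Ici i, A i k * w (Sum.inl k) (Λ.zeta (Sum.inl i) (Sum.inl k) x)) ∧
    (∀ i : Fin p, R w (Sum.inr i) =ᵐ[leb 1] fun x =>
      ∑ k ∈ Finset.Iic i, B i k * w (Sum.inr k) (Λ.zeta (Sum.inr i) (Sum.inr k) x))

end HypSys

end

/-! Measured by the travel time `phi i x = ∫_0^x 1/λ_i`, every characteristic moves at unit speed
(`phi_chi`), and `zeta i k` is the map that keeps the travel time while passing from component `i`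
to component `k` (`phi_zeta`). Hence `zeta i k` conjugates the flow of `λ_i` to that of `λ_k`
(`chi_zeta`): composing the `k`-th component of a solution with `zeta i k` gives a function carried
along the `i`-th characteristics, and such functions may be added to the `i`-th component with
constant coefficients.

The composition needs `zeta i k` to map `[0,1]` into itself. Within a sign block this holds when `k`
is not faster than `i` (`zeta_le`), that is `i ≤ k` in the block `-` and `k ≤ i` in the block `+`.
This is the origin of the two triangular shapes.

Since `zeta i k 0 = 0`, the combination acts on the traces at `x = 0` as a constant matrix. With
blocks `A = U⁻¹` and `B = L`, the new trace is `w_- = U⁻¹ y_-`, and `y_+ = Q y_-` becomes `w_+ = L Q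
U w_-`. The source is composed with the same maps and rewritten in terms of `w_-`, which gives
`transformCoupling`; it depends on `U`, `L` and `G` but not on `Q`. At `x = 1` nothing has to be
matched: the values entering there define the new control, provided that they are square integrable
in time (`memLp_charValue`).

`IsSolution.comb` carries out this computation. Bijectivity comes from the relation `zeta k l ∘ zeta
i k = zeta i l`, by which composing combinations multiplies their coefficient matrices
(`comb_comb`). The inverse is the combination with the inverse triangular blocks, so the same
computation also proves surjectivity onto the solutions of the second system. -/

noncomputable section

namespace HypSys

namespace Speeds

variable {m p : ℕ} (Λ : Speeds m p)

/-! ### Travel times -/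

/-- The travel time `∫_0^x dξ / λ_i(ξ)` along the `i`-th characteristics. -/
def phi (i : Idx m p) (x : ℝ) : ℝ := ∫ ξ in (0 : ℝ)..x, (Λ.ext i ξ)⁻¹

theorem phi_zero (i : Idx m p) : Λ.phi i 0 = 0 := by simp [phi]

theorem hasDerivAt_phi (i : Idx m p) (x : ℝ) : HasDerivAt (Λ.phi i) (Λ.ext i x)⁻¹ x :=
  ((Λ.continuous_ext i).inv₀ (Λ.ext_ne_zero i)).integral_hasStrictDerivAt 0 x |>.hasDerivAt

theorem continuous_phi (i : Idx m p) : Continuous (Λ.phi i) :=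
  continuous_iff_continuousAt.2 fun x => (Λ.hasDerivAt_phi i x).continuousAt

theorem phi_bijective (i : Idx m p) : Function.Bijective (Λ.phi i) := by
  obtain ⟨ε, C, hε, hC⟩ := Λ.exists_bounds i
  have hCpos : 0 < C := hε.trans_le ((hC 0).1.trans (hC 0).2)
  rcases Λ.ext_sign i with h | h
  · refine bijective_of_le_deriv (inv_pos.2 hCpos) (Λ.hasDerivAt_phi i) fun x => ?_
    exact inv_anti₀ (h x) ((le_abs_self _).trans (hC x).2)
  · have := bijective_of_le_deriv (inv_pos.2 hCpos) (fun x => (Λ.hasDerivAt_phi i x).neg)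
      fun x => by
        rw [← inv_neg]
        exact inv_anti₀ (neg_pos.2 (h x)) ((neg_le_abs _).trans (hC x).2)
    exact (Equiv.neg ℝ).bijective.of_comp_iff' _ |>.1 this

theorem phi_injective (i : Idx m p) : Function.Injective (Λ.phi i) := (Λ.phi_bijective i).1

theorem strictMono_phi (k : Fin p) : StrictMono (Λ.phi (Sum.inr k)) :=
  strictMono_of_deriv_pos fun x => by
    rw [(Λ.hasDerivAt_phi _ x).deriv]
    exact inv_pos.2 (Λ.pos k _)

theorem strictAnti_phi (i : Fin m) : StrictAnti (Λ.phi (Sum.inl i)) :=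
  strictAnti_of_deriv_neg fun x => by
    rw [(Λ.hasDerivAt_phi _ x).deriv]
    exact inv_lt_zero.2 (Λ.neg i _)

theorem exists_lipschitz_phi (i : Idx m p) : ∃ K, LipschitzWith K (Λ.phi i) := by
  obtain ⟨ε, C, hε, hC⟩ := Λ.exists_bounds i
  refine ⟨ε⁻¹.toNNReal, lipschitzWith_of_nnnorm_deriv_le
    (fun x => (Λ.hasDerivAt_phi i x).differentiableAt) fun x => ?_⟩
  rw [(Λ.hasDerivAt_phi i x).deriv, ← NNReal.coe_le_coe, coe_nnnorm, norm_inv, Real.norm_eq_abs,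
    Real.coe_toNNReal _ (by positivity)]
  exact inv_anti₀ hε (hC x).1

/-- The inverse of the travel time. -/
def psi (i : Idx m p) : ℝ → ℝ := (Equiv.ofBijective _ (Λ.phi_bijective i)).symm

@[simp]
theorem phi_psi (i : Idx m p) (x : ℝ) : Λ.phi i (Λ.psi i x) = x :=
  (Equiv.ofBijective _ (Λ.phi_bijective i)).apply_symm_apply x

@[simp]
theorem psi_phi (i : Idx m p) (x : ℝ) : Λ.psi i (Λ.phi i x) = x :=
  (Equiv.ofBijective _ (Λ.phi_bijective i)).symm_apply_apply x

theorem continuous_psi (i : Idx m p) : Continuous (Λ.psi i) := by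
  rcases i with i | k
  · let e := (Λ.strictAnti_phi i).neg.orderIsoOfSurjective _
      (neg_surjective.comp (Λ.phi_bijective (Sum.inl i)).2)
    have h : Λ.psi (Sum.inl i) = fun x => e.symm (-x) := by
      funext x
      apply Λ.phi_injective
      rw [phi_psi]
      exact neg_injective (e.apply_symm_apply (-x)).symm
    rw [h]
    exact e.symm.continuous.comp continuous_neg
  · let e := (Λ.strictMono_phi k).orderIsoOfSurjective _ (Λ.phi_bijective _).2
    have h : Λ.psi (Sum.inr k) = e.symm := by
      funext x
      apply Λ.phi_injective
      rw [phi_psi]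
      exact (e.apply_symm_apply x).symm
    rw [h]
    exact e.symm.continuous

theorem hasDerivAt_psi (i : Idx m p) (x : ℝ) :
    HasDerivAt (Λ.psi i) (Λ.ext i (Λ.psi i x)) x := by
  have := HasDerivAt.of_local_left_inverse (Λ.continuous_psi i).continuousAt
    (Λ.hasDerivAt_phi i (Λ.psi i x)) (inv_ne_zero (Λ.ext_ne_zero i _))
    (Filter.Eventually.of_forall (Λ.phi_psi i))
  rwa [inv_inv] at this

theorem exists_lipschitz_psi (i : Idx m p) : ∃ K, LipschitzWith K (Λ.psi i) := by
  obtain ⟨ε, C, hε, hC⟩ := Λ.exists_bounds i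
  have hCpos : 0 < C := hε.trans_le ((hC 0).1.trans (hC 0).2)
  refine ⟨C.toNNReal, lipschitzWith_of_nnnorm_deriv_le
    (fun x => (Λ.hasDerivAt_psi i x).differentiableAt) fun x => ?_⟩
  rw [(Λ.hasDerivAt_psi i x).deriv, ← NNReal.coe_le_coe, coe_nnnorm, Real.norm_eq_abs,
    Real.coe_toNNReal _ hCpos.le]
  exact (hC _).2

/-- By the chain rule the travel time grows at unit rate along a characteristic. -/
theorem phi_chi (i : Idx m p) (s t x : ℝ) : Λ.phi i (Λ.chi i s t x) = Λ.phi i x + s - t := by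
  have hd : ∀ s, HasDerivAt (fun s => Λ.phi i (Λ.chi i s t x) - s) 0 s := fun s => by
    have h := ((Λ.hasDerivAt_phi i (Λ.chi i s t x)).comp s (Λ.hasDerivAt_chi i s t x)).sub
      (hasDerivAt_id s)
    rw [inv_mul_cancel₀ (Λ.ext_ne_zero i _), sub_self] at h
    exact h
  have hc := is_const_of_deriv_eq_zero (fun s => (hd s).differentiableAt)
    (fun s => (hd s).deriv) s t
  simp only [chi_self] at hc
  linarith

theorem chi_eq (i : Idx m p) (s t x : ℝ) : Λ.chi i s t x = Λ.psi i (Λ.phi i x + s - t) := by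
  rw [← phi_chi, psi_phi]

theorem phi_zeta (i k : Idx m p) (x : ℝ) : Λ.phi k (Λ.zeta i k x) = Λ.phi i x := by
  have hd : ∀ s, HasDerivAt (fun s => Λ.phi k (Λ.zeta i k s) - Λ.phi i s) 0 s := fun s => by
    have h := ((Λ.hasDerivAt_phi k (Λ.zeta i k s)).comp s (Λ.hasDerivAt_zeta i k s)).sub
      (Λ.hasDerivAt_phi i s)
    have h1 := Λ.ext_ne_zero k (Λ.zeta i k s)
    have h2 := Λ.ext_ne_zero i s
    have h0 : (Λ.ext k (Λ.zeta i k s))⁻¹ * (Λ.ext k (Λ.zeta i k s) / Λ.ext i s)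
        - (Λ.ext i s)⁻¹ = 0 := by
      field_simp
      ring
    rw [h0] at h
    exact h
  have hc := is_const_of_deriv_eq_zero (fun s => (hd s).differentiableAt)
    (fun s => (hd s).deriv) x 0
  simp only [zeta_zero, phi_zero] at hc
  linarith

theorem zeta_eq (i k : Idx m p) (x : ℝ) : Λ.zeta i k x = Λ.psi k (Λ.phi i x) := by
  rw [← Λ.phi_zeta i k, psi_phi]

theorem zeta_self (i : Idx m p) (x : ℝ) : Λ.zeta i i x = x := by
  rw [zeta_eq, psi_phi]

theorem zeta_zeta (i k l : Idx m p) (x : ℝ) : Λ.zeta k l (Λ.zeta i k x) = Λ.zeta i l x := by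
  rw [zeta_eq, phi_zeta, zeta_eq]

theorem continuous_zeta (i k : Idx m p) : Continuous (Λ.zeta i k) :=
  continuous_iff_continuousAt.2 fun x => (Λ.hasDerivAt_zeta i k x).continuousAt

theorem exists_lipschitz_zeta (i k : Idx m p) : ∃ K, LipschitzWith K (Λ.zeta i k) := by
  obtain ⟨K, hK⟩ := Λ.exists_lipschitz_phi i
  obtain ⟨K', hK'⟩ := Λ.exists_lipschitz_psi k
  rw [show Λ.zeta i k = Λ.psi k ∘ Λ.phi i from funext (Λ.zeta_eq i k)]
  exact ⟨_, hK'.comp hK⟩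

theorem sIn_eq (i : Idx m p) (t x : ℝ) :
    Λ.sIn i t x = t + Λ.phi i (entryPoint i) - Λ.phi i x := by
  have := Λ.phi_chi i (Λ.sIn i t x) t x
  rw [chi_sIn] at this
  linarith

theorem continuous_chi (i : Idx m p) : Continuous fun q : ℝ × ℝ × ℝ => Λ.chi i q.1 q.2.1 q.2.2 := by
  simp only [chi_eq]
  exact (Λ.continuous_psi i).comp ((((Λ.continuous_phi i).comp continuous_snd.snd).add
    continuous_fst).sub continuous_snd.fst)

/-- Both sides have travel time `phi i x + s - t`, and `phi k` is injective. -/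
theorem chi_zeta (i k : Idx m p) (s t x : ℝ) :
    Λ.chi k s t (Λ.zeta i k x) = Λ.zeta i k (Λ.chi i s t x) := by
  apply Λ.phi_injective k
  rw [phi_chi, phi_zeta, phi_zeta, phi_chi]

theorem sIn_le (i : Idx m p) (t : ℝ) {x : ℝ} (hx : x ∈ Icc (0 : ℝ) 1) : Λ.sIn i t x ≤ t := by
  rw [sIn_eq]
  rcases i with i | k
  · have := (Λ.strictAnti_phi i).antitone hx.2
    simp only [entryPoint]
    linarith
  · have := (Λ.strictMono_phi k).monotone hx.1
    simp only [entryPoint]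
    linarith

theorem sIn_lt (i : Idx m p) (t : ℝ) {x : ℝ} (hx : x ∈ Ioo (0 : ℝ) 1) : Λ.sIn i t x < t := by
  rw [sIn_eq]
  rcases i with i | k
  · have := Λ.strictAnti_phi i hx.2
    simp only [entryPoint]
    linarith
  · have := Λ.strictMono_phi k hx.1
    simp only [entryPoint]
    linarith

/-- Needed because the elements of `LInf` and `L2 1` carry no information outside `(0,1)`. -/
theorem chi_mem_Ioo (i : Idx m p) {s t x : ℝ} (hx : x ∈ Icc (0 : ℝ) 1)
    (hs : s ∈ Ioo (Λ.sIn i t x) t) : Λ.chi i s t x ∈ Ioo (0 : ℝ) 1 := by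
  have h := Λ.phi_chi i s t x
  have h1 := hs.1
  have h2 := hs.2
  rw [sIn_eq] at h1
  rcases i with i | k
  · simp only [entryPoint] at h1
    exact ⟨hx.1.trans_lt ((Λ.strictAnti_phi i).lt_iff_gt.1 (by linarith)),
      (Λ.strictAnti_phi i).lt_iff_gt.1 (by linarith)⟩
  · simp only [entryPoint] at h1
    exact ⟨(Λ.strictMono_phi k).lt_iff_lt.1 (by linarith),
      ((Λ.strictMono_phi k).lt_iff_lt.1 (by linarith)).trans_le hx.2⟩

theorem ext_mono_neg {i k : Fin m} (h : i ≤ k) (x : ℝ) :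
    Λ.ext (Sum.inl i) x ≤ Λ.ext (Sum.inl k) x := (Λ.strictMono_neg _).monotone h

theorem ext_mono_pos {i k : Fin p} (h : i ≤ k) (x : ℝ) :
    Λ.ext (Sum.inr i) x ≤ Λ.ext (Sum.inr k) x := (Λ.strictMono_pos _).monotone h

theorem phi_le_of_inv_le {i k : Idx m p} (h : ∀ x, (Λ.ext i x)⁻¹ ≤ (Λ.ext k x)⁻¹) {x : ℝ}
    (hx : 0 ≤ x) : Λ.phi i x ≤ Λ.phi k x :=
  intervalIntegral.integral_mono hx
    (((Λ.continuous_ext i).inv₀ (Λ.ext_ne_zero i)).intervalIntegrable _ _)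
    (((Λ.continuous_ext k).inv₀ (Λ.ext_ne_zero k)).intervalIntegrable _ _) h

end Speeds

/-! ### Ordering of the components by speed, and its effect on entry times -/

/-- The pairs of components `(i, k)` of the same kind such that the `k`-th one is not faster than
the `i`-th one. -/
def Adm {m p : ℕ} : Idx m p → Idx m p → Prop
  | Sum.inl i, Sum.inl k => i ≤ k
  | Sum.inr i, Sum.inr k => k ≤ i
  | _, _ => False

theorem Adm.refl {m p : ℕ} (i : Idx m p) : Adm i i := by
  rcases i with i | i <;> simp [Adm]

theorem Adm.trans {m p : ℕ} {i k l : Idx m p} (h : Adm i k) (h' : Adm k l) : Adm i l := by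
  rcases i with i | i <;> rcases k with k | k <;> rcases l with l | l <;>
    simp only [Adm] at h h' ⊢
  · exact h.trans h'
  · exact h'.trans h

namespace Speeds

variable {m p : ℕ} (Λ : Speeds m p) {i k : Idx m p}

theorem zeta_strictMono (h : Adm i k) : StrictMono (Λ.zeta i k) := by
  intro x y hxy
  rcases i with i | i <;> rcases k with k | k <;> simp only [Adm] at h
  · rw [← (Λ.strictAnti_phi k).lt_iff_gt, phi_zeta, phi_zeta]
    exact Λ.strictAnti_phi i hxy
  · rw [← (Λ.strictMono_phi k).lt_iff_lt, phi_zeta, phi_zeta]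
    exact Λ.strictMono_phi i hxy

/-- In the same travel time the slower component covers a shorter distance from `0`. -/
theorem zeta_le (h : Adm i k) {x : ℝ} (hx : 0 ≤ x) : Λ.zeta i k x ≤ x := by
  rcases i with i | i <;> rcases k with k | k <;> simp only [Adm] at h
  · rw [← (Λ.strictAnti_phi k).le_iff_ge, phi_zeta]
    exact Λ.phi_le_of_inv_le
      (fun y => (inv_le_inv_of_neg (Λ.neg k _) (Λ.neg i _)).2 (Λ.ext_mono_neg h y)) hx
  · rw [← (Λ.strictMono_phi k).le_iff_le, phi_zeta]
    exact Λ.phi_le_of_inv_le (fun y => inv_anti₀ (Λ.pos k _) (Λ.ext_mono_pos h y)) hx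

theorem zeta_mem_Ioo (h : Adm i k) {x : ℝ} (hx : x ∈ Ioo (0 : ℝ) 1) :
    Λ.zeta i k x ∈ Ioo (0 : ℝ) 1 :=
  ⟨by simpa only [zeta_zero] using Λ.zeta_strictMono h hx.1, (Λ.zeta_le h hx.1.le).trans_lt hx.2⟩

theorem zeta_mem_Icc (h : Adm i k) {x : ℝ} (hx : x ∈ Icc (0 : ℝ) 1) :
    Λ.zeta i k x ∈ Icc (0 : ℝ) 1 :=
  ⟨by simpa only [zeta_zero] using (Λ.zeta_strictMono h).monotone hx.1,
    (Λ.zeta_le h hx.1).trans hx.2⟩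

/-- When the `i`-th characteristic is at `1`, the `k`-th one through its image is at `zeta i k 1`,
and the entry time may be computed from that earlier point. The next lemma and `bdry_zeta_neg` use
the same remark; it identifies the new control. -/
theorem sIn_zeta_neg {i k : Fin m} (t x : ℝ) :
    Λ.sIn (Sum.inl k) t (Λ.zeta (Sum.inl i) (Sum.inl k) x)
      = Λ.sIn (Sum.inl k) (Λ.sIn (Sum.inl i) t x) (Λ.zeta (Sum.inl i) (Sum.inl k) 1) := by
  simp only [sIn_eq, phi_zeta, entryPoint]
  ring

theorem chi_zeta_sIn {i k : Fin m} (s t x : ℝ) :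
    Λ.chi (Sum.inl k) s t (Λ.zeta (Sum.inl i) (Sum.inl k) x)
      = Λ.chi (Sum.inl k) s (Λ.sIn (Sum.inl i) t x) (Λ.zeta (Sum.inl i) (Sum.inl k) 1) := by
  simp only [chi_eq, sIn_eq, phi_zeta, entryPoint]
  ring_nf

/-- Components `+` enter at `0`, which is fixed by `zeta`. -/
theorem sIn_zeta_pos {i k : Fin p} (t x : ℝ) :
    Λ.sIn (Sum.inr k) t (Λ.zeta (Sum.inr i) (Sum.inr k) x) = Λ.sIn (Sum.inr i) t x := by
  simp only [sIn_eq, phi_zeta, entryPoint, phi_zero]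

/-- Ensures that the time interval of the `i`-th source integral is contained in that of the `k`-th
one, so that the latter can be cut at the later entry time. -/
theorem sIn_zeta_le (h : Adm i k) (t x : ℝ) : Λ.sIn k t (Λ.zeta i k x) ≤ Λ.sIn i t x := by
  rcases i with i | i <;> rcases k with k | k <;> simp only [Adm] at h
  · simp only [sIn_eq, phi_zeta, entryPoint]
    have := Λ.phi_le_of_inv_le (i := Sum.inl k) (k := Sum.inl i)
      (fun y => (inv_le_inv_of_neg (Λ.neg k _) (Λ.neg i _)).2 (Λ.ext_mono_neg h y)) zero_le_one
    linarith
  · rw [sIn_zeta_pos]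

end Speeds

/-! ### Maps with bounded image measure -/

/-- A measurable map whose image measure is bounded by a finite multiple of the reference
measure: composition with it is bounded on all the `L^p` spaces. -/
structure BoundedMap {α β : Type*} [MeasurableSpace α] [MeasurableSpace β] (f : α → β)
    (μ : Measure α) (ν : Measure β) : Prop where
  measurable : Measurable f
  map_le : ∃ c : ℝ≥0, μ.map f ≤ (c : ℝ≥0∞) • ν

namespace BoundedMap

variable {α β : Type*} [MeasurableSpace α] [MeasurableSpace β] {f : α → β}
  {μ : Measure α} {ν : Measure β}

theorem quasiMeasurePreserving (h : BoundedMap f μ ν) : Measure.QuasiMeasurePreserving f μ ν :=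
  ⟨h.measurable, by
    obtain ⟨c, hc⟩ := h.map_le
    exact Measure.absolutelyContinuous_of_le_smul hc⟩

theorem restrict (h : BoundedMap f μ ν) {s : Set α} {t : Set β} (hst : MapsTo f s t) :
    BoundedMap f (μ.restrict s) (ν.restrict t) := by
  refine ⟨h.measurable, ?_⟩
  obtain ⟨c, hc⟩ := h.map_le
  refine ⟨c, Measure.le_iff.2 fun A hA => ?_⟩
  have hA' := h.measurable hA
  rw [Measure.map_apply h.measurable hA, Measure.restrict_apply hA', Measure.smul_apply,
    Measure.restrict_apply hA]
  calc μ (f ⁻¹' A ∩ s) ≤ μ (f ⁻¹' (A ∩ t)) :=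
        measure_mono fun x hx => ⟨hx.1, hst hx.2⟩
    _ ≤ μ.map f (A ∩ t) := Measure.le_map_apply h.measurable.aemeasurable _
    _ ≤ ((c : ℝ≥0∞) • ν) (A ∩ t) := hc _

theorem eLpNorm_comp_le (h : BoundedMap f μ ν) (q : ℝ≥0∞) :
    ∃ C : ℝ≥0, ∀ g : β → ℝ, AEStronglyMeasurable g ν →
      eLpNorm (g ∘ f) q μ ≤ C * eLpNorm g q ν := by
  obtain ⟨c, hc⟩ := h.map_le
  refine ⟨c ^ (1 / q).toReal, fun g hg => ?_⟩
  rw [← eLpNorm_map_measure (hg.mono_ac h.quasiMeasurePreserving.absolutelyContinuous)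
    h.measurable.aemeasurable]
  rw [ENNReal.coe_rpow_of_nonneg _ ENNReal.toReal_nonneg]
  exact eLpNorm_le_of_measure_le_smul hc

theorem memLp_comp (h : BoundedMap f μ ν) {q : ℝ≥0∞} {g : β → ℝ} (hg : MemLp g q ν) :
    MemLp (g ∘ f) q μ := by
  obtain ⟨C, hC⟩ := h.eLpNorm_comp_le q
  exact ⟨hg.1.comp_quasiMeasurePreserving h.quasiMeasurePreserving,
    (hC g hg.1).trans_lt (ENNReal.mul_lt_top ENNReal.coe_lt_top hg.2)⟩

/-- Composition with a map with bounded image measure, on `L^q`. -/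
def compLp (h : BoundedMap f μ ν) (q : ℝ≥0∞) [Fact (1 ≤ q)] : Lp ℝ q ν →L[ℝ] Lp ℝ q μ :=
  LinearMap.mkContinuousOfExistsBound
    { toFun := fun g => (h.memLp_comp (Lp.memLp g)).toLp
      map_add' := fun g g' => by
        rw [← MemLp.toLp_add]
        exact MemLp.toLp_congr _ _
          (h.quasiMeasurePreserving.ae_eq_comp (Lp.coeFn_add g g'))
      map_smul' := fun r g => by
        rw [RingHom.id_apply, ← MemLp.toLp_const_smul]
        exact MemLp.toLp_congr _ _
          (h.quasiMeasurePreserving.ae_eq_comp (Lp.coeFn_smul r g)) }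
    (by
      obtain ⟨C, hC⟩ := h.eLpNorm_comp_le q
      refine ⟨C, fun g => ?_⟩
      have h1 := hC g (Lp.memLp g).1
      have h2 := ENNReal.toReal_mono
        (ENNReal.mul_lt_top ENNReal.coe_lt_top (Lp.memLp g).2).ne h1
      rw [ENNReal.toReal_mul] at h2
      rwa [← Lp.norm_toLp _ (h.memLp_comp (Lp.memLp g)), ← Lp.norm_def] at h2)

theorem coeFn_compLp (h : BoundedMap f μ ν) (q : ℝ≥0∞) [Fact (1 ≤ q)] (g : Lp ℝ q ν) :
    h.compLp q g =ᵐ[μ] fun x => g (f x) :=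
  MemLp.coeFn_toLp (h.memLp_comp (Lp.memLp g))

end BoundedMap

/-- The preimage of `A` under `f` lies in `g '' A`, and a `K`-Lipschitz map of the line multiplies
lengths by at most `K`. -/
theorem boundedMap_of_leftInverse {f g : ℝ → ℝ} (hf : Continuous f) {K : ℝ≥0}
    (hg : LipschitzWith K g) (h : Function.LeftInverse g f) : BoundedMap f volume volume := by
  refine ⟨hf.measurable, K, Measure.le_iff.2 fun A hA => ?_⟩
  rw [Measure.map_apply hf.measurable hA, Measure.smul_apply, smul_eq_mul]
  calc volume (f ⁻¹' A) ≤ volume (g '' A) := measure_mono fun x hx => ⟨f x, hx, h x⟩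
    _ ≤ K * volume A := by
      have := hg.hausdorffMeasure_image_le zero_le_one A
      rwa [hausdorffMeasure_real, ENNReal.rpow_one] at this

namespace Speeds

variable {m p : ℕ} (Λ : Speeds m p)

theorem boundedMap_zeta_volume (i k : Idx m p) : BoundedMap (Λ.zeta i k) volume volume := by
  obtain ⟨K, hK⟩ := Λ.exists_lipschitz_zeta k i
  refine boundedMap_of_leftInverse (Λ.continuous_zeta i k) hK fun x => ?_
  rw [zeta_zeta, zeta_self]

theorem boundedMap_zeta {i k : Idx m p} (h : Adm i k) :
    BoundedMap (Λ.zeta i k) (leb 1) (leb 1) :=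
  (Λ.boundedMap_zeta_volume i k).restrict fun _ hx => Λ.zeta_mem_Ioo h hx

theorem boundedMap_chi_fst (i : Idx m p) (t x : ℝ) :
    BoundedMap (fun s => Λ.chi i s t x) volume volume := by
  obtain ⟨K, hK⟩ := Λ.exists_lipschitz_phi i
  refine boundedMap_of_leftInverse (g := fun y => Λ.phi i y + (t - Λ.phi i x))
    ((Λ.continuous_chi i).comp (by fun_prop : Continuous fun s : ℝ => (s, t, x)))
    (hK.add (.const _)) fun s => ?_
  simp only [phi_chi]
  ring

theorem boundedMap_chi_snd (i : Idx m p) (s x : ℝ) :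
    BoundedMap (fun t => Λ.chi i s t x) volume volume := by
  obtain ⟨K, hK⟩ := Λ.exists_lipschitz_phi i
  refine boundedMap_of_leftInverse (g := fun y => -Λ.phi i y + (s + Λ.phi i x))
    ((Λ.continuous_chi i).comp (by fun_prop : Continuous fun t : ℝ => (s, t, x)))
    (hK.neg.add (.const _)) fun t => ?_
  simp only [phi_chi]
  ring

theorem boundedMap_chi_thd (i : Idx m p) (s t : ℝ) :
    BoundedMap (fun x => Λ.chi i s t x) volume volume := by
  obtain ⟨K, hK⟩ := Λ.exists_lipschitz_phi i
  obtain ⟨K', hK'⟩ := Λ.exists_lipschitz_psi i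
  refine boundedMap_of_leftInverse (g := Λ.psi i ∘ fun y => Λ.phi i y + (t - s))
    ((Λ.continuous_chi i).comp (by fun_prop : Continuous fun x : ℝ => (s, t, x)))
    (hK'.comp (hK.add (.const _))) fun x => ?_
  simp only [Function.comp, phi_chi]
  rw [show Λ.phi i x + s - t + (t - s) = Λ.phi i x by ring, psi_phi]

theorem continuous_sIn (i : Idx m p) : Continuous fun q : ℝ × ℝ => Λ.sIn i q.1 q.2 := by
  simp only [sIn_eq]
  have := Λ.continuous_phi i
  fun_prop

theorem boundedMap_sIn (i : Idx m p) (x : ℝ) :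
    BoundedMap (fun t => Λ.sIn i t x) volume volume := by
  refine boundedMap_of_leftInverse (g := fun s => id s + (Λ.phi i x - Λ.phi i (entryPoint i)))
    ((Λ.continuous_sIn i).comp (by fun_prop : Continuous fun t : ℝ => (t, x)))
    (LipschitzWith.id.add (.const _)) fun t => ?_
  simp only [sIn_eq, id]
  ring

/-- It suffices to treat slices: `t` is frozen here, `x` for the entry time below. These two facts
transfer almost everywhere properties of the data and of the traces to almost every `(t,x)`. -/
theorem quasiMeasurePreserving_chi (i : Idx m p) (s : ℝ) :
    Measure.QuasiMeasurePreserving (fun q : ℝ × ℝ => Λ.chi i s q.1 q.2)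
      (volume.prod volume) volume :=
  QuasiMeasurePreserving.prod_of_right ((Λ.continuous_chi i).comp
    (by fun_prop : Continuous fun q : ℝ × ℝ => (s, q.1, q.2))).measurable
    (.of_forall fun t => (Λ.boundedMap_chi_thd i s t).quasiMeasurePreserving)

theorem quasiMeasurePreserving_sIn (i : Idx m p) :
    Measure.QuasiMeasurePreserving (fun q : ℝ × ℝ => Λ.sIn i q.1 q.2)
      (volume.prod volume) volume :=
  QuasiMeasurePreserving.prod_of_left (Λ.continuous_sIn i).measurable
    (.of_forall fun x => (Λ.boundedMap_sIn i x).quasiMeasurePreserving)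

end Speeds

/-! ### Combination of components along the characteristic changes of variables -/

section Comb

variable {m p : ℕ} (Λ : Speeds m p) (q : ℝ≥0∞) [Fact (1 ≤ q)]

open Classical in
/-- Composition with `ζ_{ik}` on `L^q(0,1)`, for admissible pairs of components. -/
def transport (i k : Idx m p) : Lp ℝ q (leb 1) →L[ℝ] Lp ℝ q (leb 1) :=
  if h : Adm i k then (Λ.boundedMap_zeta h).compLp q else 0

variable {q}

theorem coeFn_transport {i k : Idx m p} (h : Adm i k) (g : Lp ℝ q (leb 1)) :
    transport Λ q i k g =ᵐ[leb 1] fun x => g (Λ.zeta i k x) := by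
  rw [transport, dif_pos h]
  exact BoundedMap.coeFn_compLp _ _ _

theorem transport_transport {i k l : Idx m p} (h : Adm i k) (h' : Adm k l)
    (g : Lp ℝ q (leb 1)) :
    transport Λ q i k (transport Λ q k l g) = transport Λ q i l g := by
  refine Lp.ext ?_
  filter_upwards [coeFn_transport Λ h (transport Λ q k l g), coeFn_transport Λ (h.trans h') g,
    (Λ.boundedMap_zeta h).quasiMeasurePreserving.ae (coeFn_transport Λ h' g)] with x h1 h2 h3
  rw [h1, h2, h3, Λ.zeta_zeta]

theorem transport_self (i : Idx m p) (g : Lp ℝ q (leb 1)) : transport Λ q i i g = g := by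
  refine Lp.ext ?_
  filter_upwards [coeFn_transport Λ (Adm.refl i) g] with x h
  rw [h, Λ.zeta_self]

/-- Matrices that only involve admissible pairs of components. -/
def AdmSupported (M : Matrix (Idx m p) (Idx m p) ℝ) : Prop := ∀ i k, ¬ Adm i k → M i k = 0

variable (q) in
/-- The combination of the components with coefficients `M` along the characteristic changes of
variables. -/
def comb (M : Matrix (Idx m p) (Idx m p) ℝ) :
    (Idx m p → Lp ℝ q (leb 1)) →L[ℝ] (Idx m p → Lp ℝ q (leb 1)) :=
  ContinuousLinearMap.pi fun i =>
    ∑ k, M i k • (transport Λ q i k).comp (ContinuousLinearMap.proj k)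

theorem comb_apply (M : Matrix (Idx m p) (Idx m p) ℝ) (w : Idx m p → Lp ℝ q (leb 1))
    (i : Idx m p) : comb Λ q M w i = ∑ k, M i k • transport Λ q i k (w k) := by
  simp [comb]

theorem coeFn_comb {M : Matrix (Idx m p) (Idx m p) ℝ} (hM : AdmSupported M)
    (w : Idx m p → Lp ℝ q (leb 1)) (i : Idx m p) :
    comb Λ q M w i =ᵐ[leb 1] fun x => ∑ k, M i k * w k (Λ.zeta i k x) := by
  rw [comb_apply]
  have h : ∀ k, (M i k • transport Λ q i k (w k) : Lp ℝ q (leb 1)) =ᵐ[leb 1]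
      fun x => M i k * w k (Λ.zeta i k x) := fun k => by
    by_cases hk : Adm i k
    · filter_upwards [Lp.coeFn_smul (M i k) (transport Λ q i k (w k)),
        coeFn_transport Λ hk (w k)] with x h1 h2
      rw [h1, Pi.smul_apply, h2, smul_eq_mul]
    · rw [hM i k hk, zero_smul]
      filter_upwards [Lp.coeFn_zero ℝ q (leb 1)] with x h1
      rw [h1, Pi.zero_apply, zero_mul]
  filter_upwards [Lp.coeFn_finsetSum Finset.univ fun k => M i k • transport Λ q i k (w k),
    ae_all_iff.2 h] with x h1 h2
  rw [h1, Finset.sum_apply]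
  exact Finset.sum_congr rfl fun k _ => h2 k

/-- Multiplicativity reflects `zeta k l ∘ zeta i k = zeta i l`. Products through an inadmissible
pair vanish because one of the two coefficients does. -/
theorem comb_comb {M M' : Matrix (Idx m p) (Idx m p) ℝ} (hM : AdmSupported M)
    (hM' : AdmSupported M') (w : Idx m p → Lp ℝ q (leb 1)) :
    comb Λ q M' (comb Λ q M w) = comb Λ q (M' * M) w := by
  funext i
  simp only [comb_apply, map_sum, map_smul, Matrix.mul_apply, Finset.smul_sum, Finset.sum_smul,
    smul_smul]
  rw [Finset.sum_comm]
  refine Finset.sum_congr rfl fun l _ => Finset.sum_congr rfl fun k _ => ?_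
  by_cases h : Adm i k
  · by_cases h' : Adm k l
    · rw [transport_transport Λ h h']
    · simp [hM k l h']
  · simp [hM' i k h]

theorem comb_one (w : Idx m p → Lp ℝ q (leb 1)) : comb Λ q 1 w = w := by
  funext i
  rw [comb_apply, Finset.sum_eq_single i (fun k _ hk => by simp [Matrix.one_apply_ne' hk])
    (fun h => absurd (Finset.mem_univ i) h), transport_self, Matrix.one_apply_eq, one_smul]

end Comb

theorem ae_norm_le_norm_lpTop {α : Type*} [MeasurableSpace α] {μ : Measure α} (g : Lp ℝ ∞ μ) :
    ∀ᵐ x ∂μ, ‖g x‖ ≤ ‖g‖ := by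
  filter_upwards [ae_le_eLpNormEssSup (f := g) (μ := μ)] with x hx
  rw [← eLpNorm_exponent_top] at hx
  rw [Lp.norm_def, ← toReal_enorm]
  exact ENNReal.toReal_mono (Lp.eLpNorm_ne_top g) hx

/-! ### Square integrability in time of the values carried by characteristics -/

section Source

variable {m p : ℕ} (Λ : Speeds m p) {T : ℝ}

theorem boundedMap_chi_restrict (i : Idx m p) {t x a : ℝ} (hx : x ∈ Icc (0 : ℝ) 1)
    (ha : Λ.sIn i t x ≤ a) :
    BoundedMap (fun s => Λ.chi i s t x) (volume.restrict (Ioo a t)) (leb 1) :=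
  (Λ.boundedMap_chi_fst i t x).restrict fun _ hs =>
    Λ.chi_mem_Ioo i hx ⟨ha.trans_lt hs.1, hs.2⟩

theorem intervalIntegrable_source (i : Idx m p) (g : LInf) (v : L2 T) {t x a b : ℝ}
    (ht : t ≤ T) (hx : x ∈ Icc (0 : ℝ) 1) (ha : Λ.sIn i t x ≤ a) (ha0 : 0 ≤ a) (hab : a ≤ b)
    (hb : b ≤ t) :
    IntervalIntegrable (fun s => g (Λ.chi i s t x) * v s) volume a b := by
  rw [intervalIntegrable_iff_integrableOn_Ioo_of_le hab]
  have h1 : Integrable v (volume.restrict (Ioo a b)) :=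
    ((Lp.memLp v).integrable one_le_two).mono_measure
      (Measure.restrict_mono (Ioo_subset_Ioo ha0 (hb.trans ht)) le_rfl)
  have h2 : MemLp (fun s => g (Λ.chi i s t x)) ∞ (volume.restrict (Ioo a b)) :=
    ((boundedMap_chi_restrict Λ i hx ha).memLp_comp (Lp.memLp g)).mono_measure
      (Measure.restrict_mono (Ioo_subset_Ioo_right hb) le_rfl)
  exact h1.mul_of_top_right h2

/-- The integral is bounded in `t` by `‖g‖ ∫ |v|`, and `(0,T)` has finite measure. The point `x` is
fixed, endpoints included. -/
theorem memLp_source (i : Idx m p) (g : LInf) (v : L2 T) {x : ℝ} (hx : x ∈ Icc (0 : ℝ) 1) :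
    MemLp (fun t => ∫ s in (max 0 (Λ.sIn i t x))..t, g (Λ.chi i s t x) * v s) 2 (leb T) := by
  -- Extending the integrand by zero outside `H` replaces the variable limits by an integral over
  -- `ℝ`, which makes measurability in `t` a Fubini statement.
  set H : Set (ℝ × ℝ) := {q | max 0 (Λ.sIn i q.1 x) < q.2 ∧ q.2 < q.1} with hH
  have hsIn : Continuous fun q : ℝ × ℝ => Λ.sIn i q.1 x :=
    (Λ.continuous_sIn i).comp (by fun_prop : Continuous fun q : ℝ × ℝ => (q.1, x))
  have hHm : MeasurableSet H :=
    (measurableSet_lt (continuous_const.max hsIn).measurable measurable_snd).inter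
      (measurableSet_lt measurable_snd measurable_fst)
  set F : ℝ × ℝ → ℝ := H.indicator fun q => g (Λ.chi i q.2 q.1 x) * v q.2 with hF
  have hFm : StronglyMeasurable F := by
    refine StronglyMeasurable.indicator (.mul ?_ ?_) hHm
    · exact (Lp.stronglyMeasurable g).comp_measurable ((Λ.continuous_chi i).comp
        (by fun_prop : Continuous fun q : ℝ × ℝ => (q.2, q.1, x))).measurable
    · exact (Lp.stronglyMeasurable v).comp_measurable measurable_snd
  have heq : ∀ t, t ∈ Ioo 0 T →
      ∫ s in (max 0 (Λ.sIn i t x))..t, g (Λ.chi i s t x) * v s = ∫ s, F (t, s) := fun t ht => by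
    rw [intervalIntegral.integral_of_le (max_le ht.1.le (Λ.sIn_le i t hx)),
      integral_Ioc_eq_integral_Ioo, ← integral_indicator measurableSet_Ioo]
    rfl
  have hv : Integrable (fun s => ‖g‖ * ‖v s‖) (leb T) :=
    ((Lp.memLp v).integrable one_le_two).norm.const_mul _
  have hbound : ∀ t, t ∈ Ioo 0 T → ‖∫ s, F (t, s)‖ ≤ ∫ s in Ioo 0 T, ‖g‖ * ‖v s‖ := fun t ht => by
    rw [← integral_indicator measurableSet_Ioo]
    refine norm_integral_le_of_norm_le ((integrable_indicator_iff measurableSet_Ioo).2 hv) ?_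
    have h1 := (boundedMap_chi_restrict Λ i hx (le_max_right 0 _)).quasiMeasurePreserving.ae
      (ae_norm_le_norm_lpTop g) (μa := volume.restrict (Ioo (max 0 (Λ.sIn i t x)) t))
    rw [ae_restrict_iff' measurableSet_Ioo] at h1
    filter_upwards [h1] with s hs
    by_cases h : (t, s) ∈ H
    · rw [hF, indicator_of_mem h, norm_mul, indicator_of_mem
        (show s ∈ Ioo 0 T from ⟨(le_max_left _ _).trans_lt h.1, h.2.trans ht.2⟩)]
      exact mul_le_mul_of_nonneg_right (hs h) (norm_nonneg _)
    · rw [hF, indicator_of_notMem h, norm_zero]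
      exact indicator_nonneg (fun s _ => by positivity) s
  have hae : ∀ᵐ t ∂(leb T), t ∈ Ioo 0 T := ae_restrict_mem measurableSet_Ioo
  refine MemLp.of_bound ((hFm.integral_prod_right' (ν := volume)).aestronglyMeasurable.congr ?_)
    (∫ s in Ioo 0 T, ‖g‖ * ‖v s‖) ?_
  · filter_upwards [hae] with t ht using (heq t ht).symm
  · filter_upwards [hae] with t ht
    rw [heq t ht]
    exact hbound t ht

theorem memLp_bdry (Q : Matrix (Fin p) (Fin m) ℝ) (y₀ : State m p) (u : Fin m → L2 T)
    (v : Fin m → ℝ → ℝ) (i : Fin m) {x : ℝ} (hx : x ∈ Icc (0 : ℝ) 1) :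
    MemLp (fun t => bdry Λ Q (fun k => y₀ k) (fun j => u j) v (Sum.inl i) t x) 2 (leb T) := by
  classical
  set S : Set ℝ := {t | 0 < Λ.sIn (Sum.inl i) t x} with hS
  have hSm : MeasurableSet S :=
    measurableSet_lt measurable_const (Λ.boundedMap_sIn (Sum.inl i) x).measurable
  have h : (fun t => bdry Λ Q (fun k => y₀ k) (fun j => u j) v (Sum.inl i) t x)
      = S.piecewise (u i ∘ fun t => Λ.sIn (Sum.inl i) t x)
        (y₀ (Sum.inl i) ∘ fun t => Λ.chi (Sum.inl i) 0 t x) := by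
    funext t
    by_cases ht : 0 < Λ.sIn (Sum.inl i) t x
    · rw [piecewise_eq_of_mem _ _ _ (show t ∈ S from ht)]
      simp only [bdry, if_pos ht, Function.comp]
    · rw [piecewise_eq_of_notMem _ _ _ (show t ∉ S from ht)]
      simp only [bdry, if_neg ht, Function.comp]
  rw [h]
  refine MemLp.piecewise hSm ?_ ?_
  · rw [Measure.restrict_restrict hSm]
    refine ((Λ.boundedMap_sIn (Sum.inl i) x).restrict (t := Ioo 0 T) fun t ht => ?_).memLp_comp
      (Lp.memLp (u i))
    exact ⟨ht.1, (Λ.sIn_le _ t hx).trans_lt ht.2.2⟩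
  · rw [Measure.restrict_restrict hSm.compl]
    have hy : MemLp (y₀ (Sum.inl i)) 2 (volume.restrict (Ioo 0 1)) := Lp.memLp _
    -- The half-open interval is needed because a characteristic with entry time exactly `0` starts
    -- from the point `1`.
    rw [restrict_Ioo_eq_restrict_Ioc] at hy
    refine ((Λ.boundedMap_chi_snd (Sum.inl i) 0 x).restrict fun t ht => ?_).memLp_comp hy
    rcases (not_lt.1 (show ¬ 0 < Λ.sIn (Sum.inl i) t x from ht.1)).lt_or_eq with h0 | h0
    · exact Ioo_subset_Ioc_self (Λ.chi_mem_Ioo _ hx ⟨h0, ht.2.1⟩)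
    · have := Λ.chi_sIn (Sum.inl i) t x
      rw [h0] at this
      rw [this]
      simp [Speeds.entryPoint]

/-- The right-hand side of the equation satisfied by the solutions along the characteristics. -/
def charValue (Q : Matrix (Fin p) (Fin m) ℝ) (G : Matrix (Idx m p) (Fin m) LInf)
    (y₀ : State m p) (u v : Fin m → L2 T) (i : Idx m p) (t x : ℝ) : ℝ :=
  bdry Λ Q (fun k => y₀ k) (fun j => u j) (fun j => v j) i t x
    + ∑ j, ∫ s in (max 0 (Λ.sIn i t x))..t, G i j (Λ.chi i s t x) * v j s

/-- The equation only holds for almost every `(t,x)`, but its right-hand side makes sense at each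
fixed `x`. Taken at `x = zeta i k 1`, it supplies the control of the transformed system. -/
theorem memLp_charValue (Q : Matrix (Fin p) (Fin m) ℝ) (G : Matrix (Idx m p) (Fin m) LInf)
    (y₀ : State m p) (u v : Fin m → L2 T) (i : Fin m) {x : ℝ} (hx : x ∈ Icc (0 : ℝ) 1) :
    MemLp (fun t => charValue Λ Q G y₀ u v (Sum.inl i) t x) 2 (leb T) :=
  (memLp_bdry Λ Q y₀ u _ i hx).add
    (memLp_finsetSum _ fun j _ => memLp_source Λ _ (G _ j) (v j) hx)

/-! ### The transformed coupling and its source integrals -/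

/-- The internal coupling of the transformed system. -/
def transformCoupling (M : Matrix (Idx m p) (Idx m p) ℝ) (A' : Matrix (Fin m) (Fin m) ℝ)
    (G : Matrix (Idx m p) (Fin m) LInf) : Matrix (Idx m p) (Fin m) LInf :=
  Matrix.of fun i l => ∑ j, A' j l • comb Λ ∞ M (fun k => G k j) i

/-- Two independent cancellations: `M' * M = 1` on the rows through `comb_comb`, and `A' * A = 1` on
the columns. -/
theorem transformCoupling_transformCoupling {M M' : Matrix (Idx m p) (Idx m p) ℝ}
    {A A' : Matrix (Fin m) (Fin m) ℝ} (hM : AdmSupported M) (hM' : AdmSupported M')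
    (h : M' * M = 1) (hA : A' * A = 1) (G : Matrix (Idx m p) (Fin m) LInf) :
    transformCoupling Λ M' A (transformCoupling Λ M A' G) = G := by
  ext1 i l
  have h1 : ∀ j, (fun k => transformCoupling Λ M A' G k j)
      = ∑ j', A' j' j • comb Λ ∞ M (fun k => G k j') := fun j => by
    funext k
    simp [transformCoupling]
  have h2 : ∀ j, comb Λ ∞ M' (fun k => transformCoupling Λ M A' G k j) i
      = ∑ j', A' j' j • G i j' := fun j => by
    rw [h1, map_sum, Finset.sum_apply]
    refine Finset.sum_congr rfl fun j' _ => ?_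
    rw [map_smul, comb_comb Λ hM hM', h, comb_one, Pi.smul_apply]
  have h3 : transformCoupling Λ M' A (transformCoupling Λ M A' G) i l
      = ∑ j, A j l • ∑ j', A' j' j • G i j' := by
    rw [transformCoupling, Matrix.of_apply]
    exact Finset.sum_congr rfl fun j _ => by rw [h2]
  rw [h3]
  simp only [Finset.smul_sum, smul_smul]
  rw [Finset.sum_comm]
  simp only [← Finset.sum_smul]
  have h4 : ∀ j', ∑ j, A j l * A' j' j = (1 : Matrix (Fin m) (Fin m) ℝ) j' l := fun j' => by
    rw [← hA, Matrix.mul_apply]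
    exact Finset.sum_congr rfl fun j _ => mul_comm _ _
  simp only [h4]
  rw [Finset.sum_eq_single l (fun j _ hj => by rw [Matrix.one_apply_ne hj, zero_smul])
    (fun hl => absurd (Finset.mem_univ l) hl), Matrix.one_apply_eq, one_smul]

theorem coeFn_transformCoupling {M : Matrix (Idx m p) (Idx m p) ℝ} (hM : AdmSupported M)
    (A' : Matrix (Fin m) (Fin m) ℝ) (G : Matrix (Idx m p) (Fin m) LInf) (i : Idx m p)
    (l : Fin m) :
    transformCoupling Λ M A' G i l =ᵐ[leb 1]
      fun x => ∑ j, A' j l * ∑ k, M i k * G k j (Λ.zeta i k x) := by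
  rw [transformCoupling, Matrix.of_apply]
  have h : ∀ j, (A' j l • comb Λ ∞ M (fun k => G k j) i : LInf) =ᵐ[leb 1]
      fun x => A' j l * ∑ k, M i k * G k j (Λ.zeta i k x) := fun j => by
    filter_upwards [Lp.coeFn_smul (A' j l) (comb Λ ∞ M (fun k => G k j) i),
      coeFn_comb Λ hM (fun k => G k j) i] with x h1 h2
    rw [h1, Pi.smul_apply, h2, smul_eq_mul]
  filter_upwards [Lp.coeFn_fun_finsetSum Finset.univ
    fun j => A' j l • comb Λ ∞ M (fun k => G k j) i, ae_all_iff.2 h] with x h1 h2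
  rw [h1]
  exact Finset.sum_congr rfl fun j _ => h2 j

/-- This is `c ⬝ᵥ (A' A v) = c ⬝ᵥ v`, with `A'` moved onto `c`. -/
theorem sum_mul_mulVec_eq {ι : Type*} [Fintype ι] [DecidableEq ι] {A A' : Matrix ι ι ℝ}
    (h : A' * A = 1) (c v : ι → ℝ) :
    ∑ l, (∑ j, A' j l * c j) * ∑ j, A l j * v j = ∑ j, c j * v j := by
  have h1 : c ⬝ᵥ (A'.mulVec (A.mulVec v)) = c ⬝ᵥ v := by
    rw [Matrix.mulVec_mulVec, h, Matrix.one_mulVec]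
  rw [Matrix.dotProduct_mulVec] at h1
  refine Eq.trans (Finset.sum_congr rfl fun l _ => ?_) h1
  congr 1
  exact Finset.sum_congr rfl fun j _ => mul_comm _ _

/-- Under the integral, `A'` in the coupling cancels `A` in the new trace `w`, and `chi_zeta` turns
the coefficient seen along the `i`-th characteristic into that seen along the `k`-th one. -/
theorem sum_integral_transformCoupling {M : Matrix (Idx m p) (Idx m p) ℝ}
    (hM : AdmSupported M) {A A' : Matrix (Fin m) (Fin m) ℝ} (hA : A' * A = 1)
    (G : Matrix (Idx m p) (Fin m) LInf) {v w : Fin m → L2 T}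
    (hw : ∀ l, w l =ᵐ[leb T] fun s => ∑ j, A l j * v j s) (i : Idx m p) {t x a : ℝ}
    (ht : t ∈ Ioo 0 T) (hx : x ∈ Icc (0 : ℝ) 1) (ha : Λ.sIn i t x ≤ a) (ha0 : 0 ≤ a)
    (hat : a ≤ t) :
    ∑ l, ∫ s in a..t, transformCoupling Λ M A' G i l (Λ.chi i s t x) * w l s
      = ∑ k, M i k * ∑ j, ∫ s in a..t, G k j (Λ.chi k s t (Λ.zeta i k x)) * v j s := by
  have hint : ∀ k j, IntervalIntegrable
      (fun s => M i k * (G k j (Λ.chi k s t (Λ.zeta i k x)) * v j s)) volume a t := fun k j => by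
    by_cases hk : Adm i k
    · exact (intervalIntegrable_source Λ k (G k j) (v j) ht.2.le (Λ.zeta_mem_Icc hk hx)
        ((Λ.sIn_zeta_le hk t x).trans ha) ha0 hat le_rfl).const_mul _
    · simp only [hM i k hk, zero_mul]
      exact intervalIntegrable_const
  have hint' : ∀ k, IntervalIntegrable
      (fun s => ∑ j, M i k * (G k j (Λ.chi k s t (Λ.zeta i k x)) * v j s)) volume a t := fun k => by
    simpa only [Finset.sum_fn] using IntervalIntegrable.sum Finset.univ (fun j _ => hint k j)
  rw [← intervalIntegral.integral_finsetSum fun l _ => intervalIntegrable_source Λ i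
    (transformCoupling Λ M A' G i l) (w l) ht.2.le hx ha ha0 hat le_rfl]
  simp only [Finset.mul_sum, ← intervalIntegral.integral_const_mul]
  have hR : ∀ k, ∑ j, ∫ s in a..t, M i k * (G k j (Λ.chi k s t (Λ.zeta i k x)) * v j s)
      = ∫ s in a..t, ∑ j, M i k * (G k j (Λ.chi k s t (Λ.zeta i k x)) * v j s) := fun k =>
    (intervalIntegral.integral_finsetSum fun j _ => hint k j).symm
  simp only [hR]
  rw [← intervalIntegral.integral_finsetSum fun k _ => hint' k]
  rw [intervalIntegral.integral_of_le hat, intervalIntegral.integral_of_le hat,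
    ← restrict_Ioo_eq_restrict_Ioc]
  refine integral_congr_ae ?_
  have h1 : ∀ᵐ s ∂(volume.restrict (Ioo a t)), ∀ l, transformCoupling Λ M A' G i l
      (Λ.chi i s t x) = ∑ j, A' j l * ∑ k, M i k * G k j (Λ.zeta i k (Λ.chi i s t x)) :=
    ae_all_iff.2 fun l => (boundedMap_chi_restrict Λ i hx ha).quasiMeasurePreserving.ae
      (coeFn_transformCoupling Λ hM A' G i l)
  have h2 : ∀ᵐ s ∂(volume.restrict (Ioo a t)), ∀ l, w l s = ∑ j, A l j * v j s :=
    ae_all_iff.2 fun l => ae_mono (Measure.restrict_mono (Ioo_subset_Ioo ha0 ht.2.le) le_rfl)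
      (hw l)
  filter_upwards [h1, h2] with s h1 h2
  simp only [h1, h2]
  rw [sum_mul_mulVec_eq hA, Finset.sum_comm]
  refine Finset.sum_congr rfl fun j _ => ?_
  rw [Finset.sum_mul]
  refine Finset.sum_congr rfl fun k _ => ?_
  rw [Λ.chi_zeta, mul_assoc]

end Source

/-! ### Transformation of the solutions -/

section Transform

variable {m p : ℕ} (Λ : Speeds m p) {T : ℝ}

theorem ae_mem_Ioo_prod : ∀ᵐ q ∂((leb T).prod (leb 1)), q.1 ∈ Ioo 0 T ∧ q.2 ∈ Ioo (0 : ℝ) 1 := by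
  rw [Measure.prod_restrict]
  exact ae_restrict_mem (measurableSet_Ioo.prod measurableSet_Ioo)

theorem quasiMeasurePreserving_prodMap_zeta {i k : Idx m p} (h : Adm i k) :
    Measure.QuasiMeasurePreserving (fun q : ℝ × ℝ => (q.1, Λ.zeta i k q.2))
      ((leb T).prod (leb 1)) ((leb T).prod (leb 1)) :=
  QuasiMeasurePreserving.prodMap (.id (leb T))
    (Λ.boundedMap_zeta h).quasiMeasurePreserving

/-- The null set where the entry time is exactly `0` is discarded; elsewhere the foot of the
characteristic lies in the open interval. -/
theorem ae_chi_zero {P : ℝ → Prop} (hP : ∀ᵐ x ∂(leb 1), P x) (i : Idx m p) :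
    ∀ᵐ q ∂((leb T).prod (leb 1)), ¬ 0 < Λ.sIn i q.1 q.2 → P (Λ.chi i 0 q.1 q.2) := by
  rw [ae_restrict_iff' measurableSet_Ioo] at hP
  have h1 := (Λ.quasiMeasurePreserving_chi i 0).ae hP
  have h2 := (Λ.quasiMeasurePreserving_sIn i).ae (Measure.ae_ne volume (0 : ℝ))
  have h3 := ae_mem_Ioo_prod (T := T)
  rw [Measure.prod_restrict] at h3 ⊢
  filter_upwards [ae_restrict_of_ae h1, ae_restrict_of_ae h2, h3] with q h1 h2 h3 h4
  exact h1 (Λ.chi_mem_Ioo i (Ioo_subset_Icc_self h3.2)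
    ⟨lt_of_le_of_ne (not_lt.1 h4) h2, h3.1.1⟩)

theorem ae_sIn {P : ℝ → Prop} (hP : ∀ᵐ t ∂(leb T), P t) (i : Idx m p) :
    ∀ᵐ q ∂((leb T).prod (leb 1)), 0 < Λ.sIn i q.1 q.2 → P (Λ.sIn i q.1 q.2) := by
  rw [ae_restrict_iff' measurableSet_Ioo] at hP
  have h1 := (Λ.quasiMeasurePreserving_sIn i).ae hP
  have h3 := ae_mem_Ioo_prod (T := T)
  rw [Measure.prod_restrict] at h3 ⊢
  filter_upwards [ae_restrict_of_ae h1, h3] with q h1 h3 h4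
  exact h1 ⟨h4, (Λ.sIn_lt i q.1 h3.2).trans h3.1.2⟩

/-- The coefficients of the combination with blocks `A` for the components `-` and `B` for the
components `+`. -/
abbrev blockCoeff (A : Matrix (Fin m) (Fin m) ℝ) (B : Matrix (Fin p) (Fin p) ℝ) :
    Matrix (Idx m p) (Idx m p) ℝ := Matrix.fromBlocks A 0 0 B

theorem admSupported_blockCoeff {A : Matrix (Fin m) (Fin m) ℝ} {B : Matrix (Fin p) (Fin p) ℝ}
    (hA : ∀ i j, j < i → A i j = 0) (hB : ∀ i j, i < j → B i j = 0) :
    AdmSupported (blockCoeff A B) := by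
  rintro (i | i) (k | k) h <;> simp only [Adm, not_le] at h
  · exact hA i k h
  · rfl
  · rfl
  · exact hB i k h

/-- The combination of the components, as a function of time with values in `L²(0,T)`. -/
def combTrace (M : Matrix (Idx m p) (Idx m p) ℝ) (Z : C(unitInterval, Idx m p → L2 T)) :
    C(unitInterval, Idx m p → L2 T) where
  -- The projection makes the formula total; it is the identity at `zeta i k x` for admissible
  -- pairs.
  toFun x := fun i => ∑ k, M i k • Z (projIcc 0 1 zero_le_one (Λ.zeta i k x)) k
  continuous_toFun := continuous_pi fun i => continuous_finsetSum _ fun k _ =>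
    ((continuous_apply k).comp (Z.continuous.comp (continuous_projIcc.comp
      ((Λ.continuous_zeta i k).comp continuous_subtype_val)))).const_smul (M i k)

theorem coeFn_combTrace (M : Matrix (Idx m p) (Idx m p) ℝ) (Z : C(unitInterval, Idx m p → L2 T))
    (x : unitInterval) (i : Idx m p) :
    combTrace Λ M Z x i =ᵐ[leb T]
      fun t => ∑ k, M i k * Z (projIcc 0 1 zero_le_one (Λ.zeta i k x)) k t := by
  have h : ∀ k, (M i k • Z (projIcc 0 1 zero_le_one (Λ.zeta i k x)) k : L2 T) =ᵐ[leb T]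
      fun t => M i k * Z (projIcc 0 1 zero_le_one (Λ.zeta i k x)) k t := fun k =>
    Lp.coeFn_smul _ _
  filter_upwards [Lp.coeFn_fun_finsetSum Finset.univ
    fun k => M i k • Z (projIcc 0 1 zero_le_one (Λ.zeta i k x)) k, ae_all_iff.2 h] with t h1 h2
  exact h1.trans (Finset.sum_congr rfl fun k _ => h2 k)

theorem coeFn_combTrace_zero (A : Matrix (Fin m) (Fin m) ℝ) (B : Matrix (Fin p) (Fin p) ℝ)
    (Z : C(unitInterval, Idx m p → L2 T)) (i : Fin m) :
    combTrace Λ (blockCoeff A B) Z 0 (Sum.inl i) =ᵐ[leb T]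
      fun t => ∑ k, A i k * Z 0 (Sum.inl k) t := by
  filter_upwards [coeFn_combTrace Λ (blockCoeff A B) Z 0 (Sum.inl i)] with t h
  rw [h, Fintype.sum_sum_type]
  simp [Λ.zeta_zero]

theorem memLp_combControl {A : Matrix (Fin m) (Fin m) ℝ} (hA : ∀ i j, j < i → A i j = 0)
    (Q : Matrix (Fin p) (Fin m) ℝ) (G : Matrix (Idx m p) (Fin m) LInf)
    (y₀ : State m p) (u v : Fin m → L2 T) (i : Fin m) :
    MemLp (fun t => ∑ k, A i k * charValue Λ Q G y₀ u v (Sum.inl k) t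
      (Λ.zeta (Sum.inl i) (Sum.inl k) 1)) 2 (leb T) := by
  refine memLp_finsetSum _ fun k _ => ?_
  by_cases h : k < i
  · simp only [hA i k h, zero_mul]
    exact MemLp.zero
  · exact (memLp_charValue Λ Q G y₀ u v k
      (Λ.zeta_mem_Icc (i := Sum.inl i) (k := Sum.inl k) (not_lt.1 h)
        ⟨zero_le_one, le_rfl⟩)).const_mul _

/-- Cuts all the source integrals at a common time `a`. For `a = max 0 (sIn i t x)`, the part after
`a` is the source of the new system and the part before it must be its boundary or initial value. -/
theorem sum_mul_charValue_sub {M : Matrix (Idx m p) (Idx m p) ℝ} (hM : AdmSupported M)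
    (Q : Matrix (Fin p) (Fin m) ℝ) (G : Matrix (Idx m p) (Fin m) LInf)
    (y₀ : State m p) (u v : Fin m → L2 T) (i : Idx m p) {t x a : ℝ} (ht : t ∈ Ioo 0 T)
    (hx : x ∈ Icc (0 : ℝ) 1) (ha : Λ.sIn i t x ≤ a) (ha0 : 0 ≤ a) (hat : a ≤ t) :
    ∑ k, M i k * charValue Λ Q G y₀ u v k t (Λ.zeta i k x)
      = ∑ k, M i k * (bdry Λ Q (fun k => y₀ k) (fun j => u j) (fun j => v j) k t (Λ.zeta i k x)
          + ∑ j, ∫ s in (max 0 (Λ.sIn k t (Λ.zeta i k x)))..a,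
            G k j (Λ.chi k s t (Λ.zeta i k x)) * v j s)
        + ∑ k, M i k * ∑ j, ∫ s in a..t, G k j (Λ.chi k s t (Λ.zeta i k x)) * v j s := by
  rw [← Finset.sum_add_distrib]
  refine Finset.sum_congr rfl fun k _ => ?_
  by_cases hk : Adm i k
  · have hle := Λ.sIn_zeta_le hk t x
    have hx' := Λ.zeta_mem_Icc hk hx
    rw [← mul_add, add_assoc, ← Finset.sum_add_distrib, charValue]
    congr 2
    refine Finset.sum_congr rfl fun j _ => ?_
    rw [intervalIntegral.integral_add_adjacent_intervals]
    · exact intervalIntegrable_source Λ k _ _ ht.2.le hx' (le_max_right _ _) (le_max_left _ _)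
        (max_le ha0 (hle.trans ha)) hat
    · exact intervalIntegrable_source Λ k _ _ ht.2.le hx' (hle.trans ha) ha0 hat le_rfl
  · simp [hM i k hk]

theorem bdry_of_nonpos (Q : Matrix (Fin p) (Fin m) ℝ) (y₀ : Idx m p → ℝ → ℝ)
    (u v : Fin m → ℝ → ℝ) {i : Idx m p} {t x : ℝ} (h : ¬ 0 < Λ.sIn i t x) :
    bdry Λ Q y₀ u v i t x = y₀ i (Λ.chi i 0 t x) := if_neg h

theorem bdry_zeta_neg (Q : Matrix (Fin p) (Fin m) ℝ) (y₀ : Idx m p → ℝ → ℝ)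
    (u v : Fin m → ℝ → ℝ) (i k : Fin m) (t x : ℝ) :
    bdry Λ Q y₀ u v (Sum.inl k) t (Λ.zeta (Sum.inl i) (Sum.inl k) x)
      = bdry Λ Q y₀ u v (Sum.inl k) (Λ.sIn (Sum.inl i) t x)
          (Λ.zeta (Sum.inl i) (Sum.inl k) 1) := by
  rw [bdry, bdry, Λ.sIn_zeta_neg, Λ.chi_zeta_sIn]

theorem IsSolution.comb {Q : Matrix (Fin p) (Fin m) ℝ} {G : Matrix (Idx m p) (Fin m) LInf}
    {y₀ : State m p} {u : Fin m → L2 T} {y : ℝ × ℝ → Idx m p → ℝ}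
    {Y : C(Icc (0 : ℝ) T, State m p)} {Z : C(unitInterval, Idx m p → L2 T)}
    (h : IsSolution Λ Q G T y₀ u y Y Z)
    {A A' : Matrix (Fin m) (Fin m) ℝ} {B : Matrix (Fin p) (Fin p) ℝ}
    (hA : ∀ i j, j < i → A i j = 0) (hB : ∀ i j, i < j → B i j = 0) (hAA : A' * A = 1)
    (R : C(State m p, State m p)) (hR : ∀ w, R w = comb Λ 2 (blockCoeff A B) w) :
    IsSolution Λ (B * Q * A') (transformCoupling Λ (blockCoeff A B) A' G) T
      (comb Λ 2 (blockCoeff A B) y₀)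
      (fun i => (memLp_combControl Λ hA Q G y₀ u (fun j => Z 0 (Sum.inl j)) i).toLp)
      (fun q i => ∑ k, blockCoeff A B i k * y (q.1, Λ.zeta i k q.2) k)
      (R.comp Y) (combTrace Λ (blockCoeff A B) Z) := by
  have hM : AdmSupported (blockCoeff A B) := admSupported_blockCoeff hA hB
  refine ⟨?_, fun i => ?_, fun i => ?_, fun i => ?_⟩
  · refine (aemeasurable_pi_iff.2 fun i => ?_).aestronglyMeasurable
    refine Finset.aemeasurable_fun_sum _ fun k _ => ?_
    by_cases hk : Adm i k
    · exact (((continuous_apply k).comp_aestronglyMeasurable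
        h.measurable).comp_quasiMeasurePreserving
          (quasiMeasurePreserving_prodMap_zeta Λ hk)).aemeasurable.const_mul _
    · simp only [hM i k hk, zero_mul]
      exact aemeasurable_const
  · filter_upwards [ae_all_iff.2 h.time] with t ht htT
    -- The restriction to admissible pairs is essential, since only these are known to keep `x` in
    -- `(0,1)`; the other coefficients vanish.
    have h1 : ∀ᵐ x ∂(leb 1), ∀ k, Adm i k →
        y (t, Λ.zeta i k x) k = Y ⟨t, htT⟩ k (Λ.zeta i k x) :=
      ae_all_iff.2 fun k => by
        by_cases hk : Adm i k
        · filter_upwards [(Λ.boundedMap_zeta hk).quasiMeasurePreserving.ae (ht k htT)] with x hx _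
          exact hx
        · exact .of_forall fun x hk' => absurd hk' hk
    rw [ContinuousMap.comp_apply, hR]
    filter_upwards [coeFn_comb Λ hM (Y ⟨t, htT⟩) i, h1] with x hx hx'
    rw [hx]
    refine Finset.sum_congr rfl fun k _ => ?_
    by_cases hk : Adm i k
    · rw [hx' k hk]
    · rw [hM i k hk, zero_mul, zero_mul]
  · have h1 : ∀ᵐ x ∂(leb 1), ∀ k, Adm i k → ∀ hx : Λ.zeta i k x ∈ Icc 0 1,
        (fun t => y (t, Λ.zeta i k x) k) =ᵐ[leb T] Z ⟨Λ.zeta i k x, hx⟩ k :=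
      ae_all_iff.2 fun k => by
        by_cases hk : Adm i k
        · filter_upwards [(Λ.boundedMap_zeta hk).quasiMeasurePreserving.ae (h.space k)] with x hx _
          exact hx
        · exact .of_forall fun x hk' => absurd hk' hk
    filter_upwards [h1] with x hx hxI
    have h2 : ∀ᵐ t ∂(leb T), ∀ k, Adm i k → y (t, Λ.zeta i k x) k
        = Z (projIcc 0 1 zero_le_one (Λ.zeta i k x)) k t :=
      ae_all_iff.2 fun k => by
        by_cases hk : Adm i k
        · have hz := Λ.zeta_mem_Icc hk hxI
          rw [projIcc_of_mem zero_le_one hz]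
          filter_upwards [hx k hk hz] with t ht _
          exact ht
        · exact .of_forall fun x hk' => absurd hk' hk
    filter_upwards [coeFn_combTrace Λ (blockCoeff A B) Z ⟨x, hxI⟩ i, h2] with t ht ht'
    rw [ht]
    refine Finset.sum_congr rfl fun k _ => ?_
    by_cases hk : Adm i k
    · rw [ht' k hk]
    · rw [hM i k hk, zero_mul, zero_mul]
  · set v : Fin m → L2 T := fun j => Z 0 (Sum.inl j) with hv
    set w : Fin m → L2 T := fun j => combTrace Λ (blockCoeff A B) Z 0 (Sum.inl j) with hw
    have hwv : ∀ l, w l =ᵐ[leb T] fun s => ∑ j, A l j * v j s := fun l =>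
      coeFn_combTrace_zero Λ A B Z l
    have h1 : ∀ᵐ q ∂((leb T).prod (leb 1)), ∀ k, Adm i k → y (q.1, Λ.zeta i k q.2) k
        = charValue Λ Q G y₀ u v k q.1 (Λ.zeta i k q.2) :=
      ae_all_iff.2 fun k => by
        by_cases hk : Adm i k
        · filter_upwards [(quasiMeasurePreserving_prodMap_zeta Λ hk).ae (h.eqn k)] with q hq _
          exact hq
        · exact .of_forall fun x hk' => absurd hk' hk
    have h2 := ae_chi_zero Λ (T := T) (coeFn_comb Λ hM y₀ i) i
    have h3 := ae_sIn Λ (T := T) (ae_all_iff.2 hwv) i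
    have h4 : ∀ᵐ q ∂((leb T).prod (leb 1)), ∀ i', i = Sum.inl i' → 0 < Λ.sIn i q.1 q.2 →
        (memLp_combControl Λ hA Q G y₀ u v i').toLp _ (Λ.sIn i q.1 q.2)
          = ∑ k, A i' k * charValue Λ Q G y₀ u v (Sum.inl k) (Λ.sIn i q.1 q.2)
            (Λ.zeta (Sum.inl i') (Sum.inl k) 1) :=
      ae_all_iff.2 fun i' => by
        filter_upwards [ae_sIn Λ (T := T)
          (memLp_combControl Λ hA Q G y₀ u v i').coeFn_toLp i] with q hq _ using hq
    filter_upwards [h1, h2, h3, h4, ae_mem_Ioo_prod (T := T)] with q h1 h2 h3 h4 hq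
    obtain ⟨t, x⟩ := q
    obtain ⟨ht, hx⟩ := hq
    have hx' := Ioo_subset_Icc_self hx
    have hst := Λ.sIn_lt i t hx
    dsimp only at h1 h2 h3 h4 ht hx hx' hst ⊢
    have e1 : ∑ k, blockCoeff A B i k * y (t, Λ.zeta i k x) k
        = ∑ k, blockCoeff A B i k * charValue Λ Q G y₀ u v k t (Λ.zeta i k x) :=
      Finset.sum_congr rfl fun k _ => by
        by_cases hk : Adm i k
        · rw [h1 k hk]
        · rw [hM i k hk, zero_mul, zero_mul]
    rw [e1, sum_mul_charValue_sub Λ hM Q G y₀ u v i ht hx' (le_max_right 0 _) (le_max_left 0 _)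
      (max_le ht.1.le hst.le), sum_integral_transformCoupling Λ hM hAA G hwv i ht hx'
      (le_max_right 0 _) (le_max_left 0 _) (max_le ht.1.le hst.le)]
    -- The sources agree. What remains is the value at time `max 0 (sIn i t x)`, in three cases:
    -- control, coupling at `x = 0`, initial data.
    congr 1
    by_cases hs : 0 < Λ.sIn i t x
    · rw [max_eq_right hs.le]
      rcases i with i | i
      · rw [Fintype.sum_sum_type]
        simp only [Matrix.fromBlocks_apply₁₁, Matrix.fromBlocks_apply₁₂, Matrix.zero_apply,
          zero_mul, Finset.sum_const_zero, add_zero]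
        rw [bdry, if_pos hs]
        -- Here the identity is the definition of the new control.
        rw [h4 i rfl hs]
        refine Finset.sum_congr rfl fun k _ => ?_
        rw [charValue, bdry_zeta_neg, Λ.sIn_zeta_neg t x]
        simp only [Λ.chi_zeta_sIn _ t x]
      · rw [Fintype.sum_sum_type]
        simp only [Matrix.fromBlocks_apply₂₁, Matrix.fromBlocks_apply₂₂, Matrix.zero_apply,
          zero_mul, Finset.sum_const_zero, zero_add]
        -- All entry times coincide, so no source accumulates before `a`; what is left is `B Q v =
        -- (B Q A') (A v)`.
        simp only [bdry, Λ.sIn_zeta_pos, if_pos hs, max_eq_right hs.le,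
          intervalIntegral.integral_same, Finset.sum_const_zero, add_zero]
        have e3 : ∀ l, combTrace Λ (blockCoeff A B) Z 0 (Sum.inl l) (Λ.sIn (Sum.inr i) t x)
            = ∑ j, A l j * v j (Λ.sIn (Sum.inr i) t x) := h3 hs
        simp only [e3]
        have e2 : (B * Q * A').mulVec (A.mulVec fun j => v j (Λ.sIn (Sum.inr i) t x)) i
            = B.mulVec (Q.mulVec fun j => v j (Λ.sIn (Sum.inr i) t x)) i := by
          rw [Matrix.mulVec_mulVec, Matrix.mul_assoc, hAA, Matrix.mul_one, Matrix.mulVec_mulVec]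
        exact e2.symm
    · rw [max_eq_left (not_lt.1 hs)]
      rw [bdry_of_nonpos Λ _ _ _ _ hs, h2 hs]
      refine Finset.sum_congr rfl fun k _ => ?_
      by_cases hk : Adm i k
      · have hk' := (Λ.sIn_zeta_le hk t x).trans (not_lt.1 hs)
        rw [max_eq_left hk', bdry_of_nonpos Λ _ _ _ _ (not_lt.2 hk')]
        simp only [intervalIntegral.integral_same, Finset.sum_const_zero, add_zero, Λ.chi_zeta]
      · rw [hM i k hk, zero_mul, zero_mul]

/-- The bijection of the state space given by a combination of the components with invertible
coefficients. -/
def combEquiv {M M' : Matrix (Idx m p) (Idx m p) ℝ} (hM : AdmSupported M)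
    (hM' : AdmSupported M') (h : M' * M = 1) : State m p ≃L[ℝ] State m p :=
  ContinuousLinearEquiv.equivOfInverse (comb Λ 2 M) (comb Λ 2 M')
    (fun w => by rw [comb_comb Λ hM hM', h, comb_one])
    (fun w => by rw [comb_comb Λ hM' hM, mul_eq_one_comm.1 h, comb_one])

theorem blockCoeff_mul_eq_one {A A' : Matrix (Fin m) (Fin m) ℝ} {B B' : Matrix (Fin p) (Fin p) ℝ}
    (hA : A' * A = 1) (hB : B' * B = 1) : blockCoeff A' B' * blockCoeff A B = 1 := by
  rw [Matrix.fromBlocks_multiply]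
  simp [hA, hB]

/-- Surjectivity is `IsSolution.comb` applied to the inverse blocks, which are triangular too and
lead back to `Q` and `G`. -/
theorem transforms_combEquiv {A A' : Matrix (Fin m) (Fin m) ℝ} {B B' : Matrix (Fin p) (Fin p) ℝ}
    (hA : ∀ i j, j < i → A i j = 0) (hB : ∀ i j, i < j → B i j = 0)
    (hA' : ∀ i j, j < i → A' i j = 0) (hB' : ∀ i j, i < j → B' i j = 0)
    (hAA : A' * A = 1) (hBB : B' * B = 1) (Q : Matrix (Fin p) (Fin m) ℝ)
    (G : Matrix (Idx m p) (Fin m) LInf) :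
    Transforms Λ (combEquiv Λ (admSupported_blockCoeff hA hB) (admSupported_blockCoeff hA' hB')
      (blockCoeff_mul_eq_one hAA hBB)) Q G (B * Q * A')
      (transformCoupling Λ (blockCoeff A B) A' G) := by
  intro T _
  refine Subset.antisymm ?_ ?_
  · rintro _ ⟨Y, ⟨y₀, u, y, Z, h⟩, rfl⟩
    exact ⟨_, _, _, _, h.comb Λ hA hB hAA _ fun _ => rfl⟩
  · rintro Y ⟨y₀, u, y, Z, h⟩
    have h' := h.comb Λ hA' hB' (mul_eq_one_comm.1 hAA)
      ⟨comb Λ 2 (blockCoeff A' B'), (comb Λ 2 (blockCoeff A' B')).continuous⟩ fun _ => rfl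
    rw [transformCoupling_transformCoupling Λ (admSupported_blockCoeff hA hB)
      (admSupported_blockCoeff hA' hB') (blockCoeff_mul_eq_one hAA hBB) hAA,
      show B' * (B * Q * A') * A = Q by
        rw [← Matrix.mul_assoc, ← Matrix.mul_assoc, hBB, Matrix.one_mul, Matrix.mul_assoc, hAA,
          Matrix.mul_one]] at h'
    refine ⟨_, ⟨_, _, _, _, h'⟩, ?_⟩
    ext1 t
    exact (combEquiv Λ (admSupported_blockCoeff hA hB) (admSupported_blockCoeff hA' hB')
      (blockCoeff_mul_eq_one hAA hBB)).apply_symm_apply (Y t)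

theorem isCharacteristicCombination_combEquiv {A : Matrix (Fin m) (Fin m) ℝ}
    {B : Matrix (Fin p) (Fin p) ℝ} {M' : Matrix (Idx m p) (Idx m p) ℝ}
    (hA : ∀ i j, j < i → A i j = 0) (hB : ∀ i j, i < j → B i j = 0)
    (hM' : AdmSupported M') (h : M' * blockCoeff A B = 1) :
    IsCharacteristicCombination Λ A B
      (combEquiv Λ (admSupported_blockCoeff hA hB) hM' h) := by
  refine fun w => ⟨fun i => ?_, fun i => ?_⟩
  · filter_upwards [coeFn_comb Λ (admSupported_blockCoeff hA hB) w (Sum.inl i)] with x hx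
    refine hx.trans ?_
    rw [Fintype.sum_sum_type]
    simp only [Matrix.fromBlocks_apply₁₁, Matrix.fromBlocks_apply₁₂, Matrix.zero_apply,
      zero_mul, Finset.sum_const_zero, add_zero]
    refine (Finset.sum_subset (Finset.subset_univ _) fun k _ hk => ?_).symm
    rw [hA i k (not_le.1 fun h => hk (Finset.mem_Ici.2 h)), zero_mul]
  · filter_upwards [coeFn_comb Λ (admSupported_blockCoeff hA hB) w (Sum.inr i)] with x hx
    refine hx.trans ?_
    rw [Fintype.sum_sum_type]
    simp only [Matrix.fromBlocks_apply₂₁, Matrix.fromBlocks_apply₂₂, Matrix.zero_apply,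
      zero_mul, Finset.sum_const_zero, zero_add]
    refine (Finset.sum_subset (Finset.subset_univ _) fun k _ hk => ?_).symm
    rw [hB i k (not_le.1 fun h => hk (Finset.mem_Iic.2 h)), zero_mul]

end Transform

/-! ### Inverses of triangular matrices, and conclusion -/

theorem inv_apply_eq_zero_of_upper {n : ℕ} {U : Matrix (Fin n) (Fin n) ℝ} (hU : IsUnit U)
    (h : ∀ i j, j < i → U i j = 0) (i j : Fin n) (hij : j < i) : U⁻¹ i j = 0 := by
  have := hU.invertible
  exact Matrix.blockTriangular_inv_of_blockTriangular (b := id) (fun i j hij => h i j hij) hij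

theorem inv_apply_eq_zero_of_lower {n : ℕ} {L : Matrix (Fin n) (Fin n) ℝ} (hL : IsUnit L)
    (h : ∀ i j, i < j → L i j = 0) (i j : Fin n) (hij : i < j) : L⁻¹ i j = 0 := by
  have := hL.invertible
  exact Matrix.blockTriangular_inv_of_blockTriangular (b := OrderDual.toDual)
    (fun i j hij => h i j hij) hij

end HypSys

end

theorem proposition4p1 {m p : ℕ} (hm : 1 ≤ m) (hp : 1 ≤ p) (Λ : HypSys.Speeds m p)
    (U : Matrix (Fin m) (Fin m) ℝ) (hU : IsUnit U) (hU_upper : ∀ i j, j < i → U i j = 0)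
    (L : Matrix (Fin p) (Fin p) ℝ) (hL : IsUnit L) (hL_lower : ∀ i j, i < j → L i j = 0) :
    ∃ Θ : Matrix (HypSys.Idx m p) (Fin m) HypSys.LInf →
        Matrix (HypSys.Idx m p) (Fin m) HypSys.LInf,
      (∀ (Q : Matrix (Fin p) (Fin m) ℝ) (G : Matrix (HypSys.Idx m p) (Fin m) HypSys.LInf),
        HypSys.Equivalent Λ Q G (L * Q * U) (Θ G)) ∧
      ∃ R : HypSys.State m p ≃L[ℝ] HypSys.State m p,
        HypSys.IsCharacteristicCombination Λ U⁻¹ L R ∧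
        ∀ (Q : Matrix (Fin p) (Fin m) ℝ) (G : Matrix (HypSys.Idx m p) (Fin m) HypSys.LInf),
          HypSys.Transforms Λ R Q G (L * Q * U) (Θ G) := by
  have hU' := (Matrix.isUnit_iff_isUnit_det U).1 hU
  have hL' := (Matrix.isUnit_iff_isUnit_det L).1 hL
  have hU_inv := HypSys.inv_apply_eq_zero_of_upper hU hU_upper
  have hL_inv := HypSys.inv_apply_eq_zero_of_lower hL hL_lower
  -- The blocks are `A = U⁻¹`, `B = L`, with inverses `A' = U`, `B' = L⁻¹`, so that `B * Q * A'` is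
  -- `L * Q * U`.
  have key := HypSys.transforms_combEquiv Λ hU_inv hL_lower hU_upper hL_inv
    (Matrix.mul_nonsing_inv U hU') (Matrix.nonsing_inv_mul L hL')
  exact ⟨HypSys.transformCoupling Λ (HypSys.blockCoeff U⁻¹ L) U,
    fun Q G => ⟨_, key Q G⟩, _,
    HypSys.isCharacteristicCombination_combEquiv Λ hU_inv hL_lower _ _, key⟩
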